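/- Fix $\kappa\in\mathbb R$ and $R>0$ with $R^2|\kappa|<1$. Equip $\mathbb D_R=\{z\in\mathbb C:|z|\le R\}$ with the metric $g_\kappa=(1+\kappa|z|^2)^{-2}|dz|^2$ and its area $dVol_\kappa$. Parameterize the inward unit vectors at the boundary by $(\beta,\alpha)\in\mathbb S^1\times(-\frac\pi2,\frac\pi2)$, where $(\beta,\alpha)$ stands for the point $Re^{i\beta}$ and the $g_\kappa$-unit vector $(1+\kappa R^2)e^{i(\beta+\pi+\alpha)}$, and equip them with the measure $d\Sigma^2=\frac{R}{1+\kappa R^2}\,d\beta\,d\alpha$. Let $$I_0f(\beta,\alpha)=\int_0^{\tau}f(\gamma_{\beta,\alpha}(t))\,dt,\qquad I_0:L^2(\mathbb D_R,dVol_\kappa)\to L^2(\mathbb S^1\times(-\tfrac\pi2,\tfrac\pi2),d\Sigma^2),$$ where $\gamma_{\beta,\alpha}$ is the unit-speed $g_\kappa$-geodesic issued from $(\beta,\alpha)$ and $\tau$ its exit time from $\mathbb D_R$. Let $I_0^*$ be the Hilbert space adjoint of the bounded operator $I_0$, and let $I_0^e$, $(I_0^e)^*=(I_0^*)^e$ denote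 the same operators for $\kappa=0$, $R=1$. Define $$\Phi(z)=\frac{1-\kappa R^2}{1-\kappa|z|^2}\,\frac zR,\qquad w(z)=\frac{1+\kappa|z|^2}{1-\kappa|z|^2},\qquad s(\alpha)=\arctan\Big(\frac{1-\kappa R^2}{1+\kappa R^2}\tan\alpha\Big),$$ and $s(\beta,\alpha)=(\beta,s(\alpha))$; then $\Phi:\mathbb D_R\to\mathbb D_1$ and $s:(-\frac\pi2,\frac\pi2)\to(-\frac\pi2,\frac\pi2)$ are bijections. Write $h^*f=f\circ h$ for pull-backs, and let functions act by multiplication. Then $$\sqrt{\frac{1+\kappa R^2}{1-\kappa R^2}}\;(\Phi^{-1})^*\,\frac1w\,I_0^*\,\sqrt{s'}\,s^*=(I_0^*)^e$$ as operators from $L^2(\mathbb S^1\times(-\frac\pi2,\frac\pi2),d\beta\,d\alpha)$ to $L^2(\mathbb D_1)$, and $$I_0^e=\frac{(1-\kappa R^2)^{3/2}}{R\,(1+\kappa R^2)^{1/2}}\;(s^{-1})^*\,\frac1{\sqrt{s'}}\,I_0\,w^2\,\Phi^*$$ as operators from $L^2(\mathbb D_1)$ to $L^2(\mathbb S^1\times(-\frac\pi2,\frac\pi2),d\beta\,d\alpha)$;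 the second identity also holds at every point $(\beta,\alpha)$ for functions on $\mathbb D_1$ and their integrals along geodesics. -/

import Mathlib

open MeasureTheory Set Metric
open scoped Real ENNReal ComplexConjugate

noncomputable section

namespace XrayDisk

instance factTwoPiPos : Fact ((0 : ℝ) < 2 * π) := ⟨Real.two_pi_pos⟩

/-! ### The Riemannian disk -/

/-- The metric `g_κ = (1 + κ|z|²)⁻² |dz|²` as a matrix in the real coordinates `(Re z, Im z)`. -/
def metric (κ : ℝ) (z : ℂ) : Matrix (Fin 2) (Fin 2) ℝ :=
  ((1 + κ * ‖z‖ ^ 2) ^ 2)⁻¹ • (1 : Matrix (Fin 2) (Fin 2) ℝ)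

/-- The coordinate vector fields of the real coordinates `(Re z, Im z)`. -/
def coordVec : Fin 2 → ℂ := ![1, Complex.I]

/-- The real coordinates `(Re v, Im v)` of a vector. -/
def coord (v : ℂ) : Fin 2 → ℝ := ![v.re, v.im]

/-- Partial derivative in the `i`-th real coordinate. -/
def partialDeriv (i : Fin 2) (F : ℂ → ℝ) (z : ℂ) : ℝ := fderiv ℝ F z (coordVec i)

/-- Christoffel symbols `Γ^k_{ij}` of the Levi-Civita connection of `g_κ`. -/
def christoffel (κ : ℝ) (k i j : Fin 2) (z : ℂ) : ℝ :=
  (1 / 2) * ∑ l : Fin 2, (metric κ z)⁻¹ k l *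
    (partialDeriv i (fun x => metric κ x j l) z + partialDeriv j (fun x => metric κ x i l) z
      - partialDeriv l (fun x => metric κ x i j) z)

/-- The right-hand side `-Γ^k_{ij}(z) v^i v^j` of the geodesic equation. -/
def geodesicAccel (κ : ℝ) (z v : ℂ) : ℂ :=
  ⟨-∑ i : Fin 2, ∑ j : Fin 2, christoffel κ 0 i j z * coord v i * coord v j,
   -∑ i : Fin 2, ∑ j : Fin 2, christoffel κ 1 i j z * coord v i * coord v j⟩

/-- The Riemannian area of `(𝔻_R, g_κ)`, extended by zero to the plane. -/
def area (κ R : ℝ) : Measure ℂ :=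
  (volume.restrict (closedBall (0 : ℂ) R)).withDensity
    (fun z => ENNReal.ofReal (Real.sqrt (metric κ z).det))

/-! ### The inward boundary in fan-beam coordinates

A pair `(β, α)`, with `β ∈ 𝕊¹ = ℝ/2πℤ` and `-π/2 < α < π/2`, stands for the boundary point
`R e^{iβ}` and the `g_κ`-unit inward vector `(1 + κR²) e^{i(β + π + α)}`. -/

/-- The point `e^{iβ}` of the unit circle. -/
def cis (β : AddCircle (2 * π)) : ℂ := (AddCircle.toCircle β : ℂ)

/-- The range of the fibre coordinate `α`. -/
def fibre : Set ℝ := Ioo (-(π / 2)) (π / 2)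

/-- The measure `dΣ² = R (1 + κR²)⁻¹ dβ dα` on the inward boundary (arclength of the boundary
circle times angle in the fibres). -/
def boundaryMeasure (κ R : ℝ) : Measure (AddCircle (2 * π) × ℝ) :=
  ENNReal.ofReal (R / (1 + κ * R ^ 2)) • (volume.prod (volume.restrict fibre))

/-! ### The geodesic X-ray transform -/

/-- `c = (τ, γ)`, where `γ` on `[0, τ]` is the unit-speed `g_κ`-geodesic issued from the point
`(β, α)` of the inward boundary and `τ` is its exit time out of `𝔻_R`. -/
def IsChord (κ R : ℝ) (p : AddCircle (2 * π) × ℝ) (c : ℝ × (ℝ → ℂ)) : Prop :=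
  0 < c.1 ∧
  (∃ v : ℝ → ℂ,
    c.2 0 = R * cis p.1 ∧
    v 0 = (1 + κ * R ^ 2 : ℝ) * cis (p.1 + ((π + p.2 : ℝ) : AddCircle (2 * π))) ∧
    ∀ t ∈ Icc 0 c.1,
      HasDerivWithinAt c.2 (v t) (Icc 0 c.1) t ∧
      HasDerivWithinAt v (geodesicAccel κ (c.2 t) (v t)) (Icc 0 c.1) t) ∧
  (∀ t ∈ Ioo 0 c.1, ‖c.2 t‖ < R) ∧
  ‖c.2 c.1‖ = R

/-- The exit time and the geodesic issued from a point of the inward boundary. -/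
def chord (κ R : ℝ) (p : AddCircle (2 * π) × ℝ) : ℝ × (ℝ → ℂ) :=
  Classical.epsilon (IsChord κ R p)

/-- The X-ray transform `I₀ f (β, α) = ∫₀^τ f(γ(t)) dt` of a function on the disk. -/
def xray (κ R : ℝ) (f : ℂ → ℂ) (p : AddCircle (2 * π) × ℝ) : ℂ :=
  ∫ t in (0 : ℝ)..(chord κ R p).1, f ((chord κ R p).2 t)

/-- The bounded operator `A : L²(𝔻_R, dVol_κ) → L²(∂₊S𝔻_R, dΣ²)` is the X-ray transform: for
every `f`, for almost every geodesic, `f` is integrable along it and `A f` is the integral. -/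
def IsXrayOperator (κ R : ℝ)
    (A : Lp ℂ 2 (area κ R) →L[ℂ] Lp ℂ 2 (boundaryMeasure κ R)) : Prop :=
  ∀ f : Lp ℂ 2 (area κ R), ∀ᵐ p ∂(boundaryMeasure κ R),
    IntervalIntegrable (fun t => f ((chord κ R p).2 t)) volume 0 (chord κ R p).1 ∧
    A f p = xray κ R f p

/-! ### The intertwining maps -/

/-- `Φ(z) = (1 - κR²)/(1 - κ|z|²) · z/R`. -/
def Phi (κ R : ℝ) (z : ℂ) : ℂ :=
  (((1 - κ * R ^ 2) / (1 - κ * ‖z‖ ^ 2) : ℝ) : ℂ) * (z / R)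

/-- The inverse `Φ⁻¹` of `Φ : 𝔻_R → 𝔻_1`. -/
def PhiInv (κ R : ℝ) : ℂ → ℂ := Function.invFunOn (Phi κ R) (closedBall 0 R)

/-- `w(z) = (1 + κ|z|²)/(1 - κ|z|²)`. -/
def weight (κ : ℝ) (z : ℂ) : ℝ := (1 + κ * ‖z‖ ^ 2) / (1 - κ * ‖z‖ ^ 2)

/-- `s(α) = arctan ((1 - κR²)/(1 + κR²) · tan α)`, used for `-π/2 < α < π/2`. -/
def sMap (κ R α : ℝ) : ℝ :=
  Real.arctan ((1 - κ * R ^ 2) / (1 + κ * R ^ 2) * Real.tan α)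

/-- The inverse `s⁻¹` of `s : (-π/2, π/2) → (-π/2, π/2)`. -/
def sInv (κ R : ℝ) : ℝ → ℝ := Function.invFunOn (sMap κ R) fibre

/-- The constant `(1 - κR²)^{3/2} / (R (1 + κR²)^{1/2})`. -/
def dualConst (κ R : ℝ) : ℝ :=
  (1 - κ * R ^ 2) ^ (3 / 2 : ℝ) / (R * (1 + κ * R ^ 2) ^ (1 / 2 : ℝ))

end XrayDisk

end

noncomputable section

namespace XrayDisk

/-! ### The geodesic equation -/

/-! The metric `g_κ` has constant curvature `4κ`, so its geodesics can be straightened by a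
projective map, and `Φ` is such a map. Moving the starting point to the origin by a Möbius isometry
writes the geodesic from `(β, α)` as `geo`, with a parameter `T` solving `T' = 1 + κT²`.
Substituting this into `Φ` shows that the image is the Euclidean chord from `(β, s(α))` (`Phi_geo`).
Along it, Euclidean arclength grows at the speed `dualConst / √s'(α)` times `w²`
(`exists_chord_reparam`). A change of variables in the line integral is then the pointwise form of
the second identity (`xray_sMap`).

The first identity is the Hilbert space adjoint of the second. `Φ` pushes `w³ dVol_κ` forward to a
constant multiple of Lebesgue measure (`isWeightedEquiv_Phi`), so the adjoint of `w² Φ^*` is a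
multiple of `(Φ⁻¹)^* w⁻¹`. Likewise `s` pushes `s' dΣ²` to a multiple of `dβ dα`
(`isWeightedEquiv_sMap`), which makes `√s' s^*` a multiple of the adjoint of `(s⁻¹)^* (√s')⁻¹`. The
constants combine to the square root in the statement (`dualConst_mul_consts`).

The `L²` operators have to be produced as well. Santaló's formula in the unit disk and
Cauchy–Schwarz on chords bound the Euclidean transform. The operator for `g_κ` is then defined by
conjugating the Euclidean one with invertible weighted compositions, and the pointwise identity
shows that it is the X-ray transform (`isXrayOperator_conj`). -/

lemma abs_kappa_mul_sq_lt_one {κ R : ℝ} (hκ : R ^ 2 * |κ| < 1) {r : ℝ} (h0 : 0 ≤ r) (hr : r ≤ R) :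
    |κ * r ^ 2| < 1 := by
  rw [abs_mul, abs_of_nonneg (sq_nonneg r)]
  have : r ^ 2 ≤ R ^ 2 := by gcongr
  nlinarith [abs_nonneg κ]

lemma one_add_pos {κ R : ℝ} (hκ : R ^ 2 * |κ| < 1) {r : ℝ} (h0 : 0 ≤ r) (hr : r ≤ R) :
    0 < 1 + κ * r ^ 2 := by
  linarith [(abs_lt.1 (abs_kappa_mul_sq_lt_one hκ h0 hr)).1]

lemma one_sub_pos {κ R : ℝ} (hκ : R ^ 2 * |κ| < 1) {r : ℝ} (h0 : 0 ≤ r) (hr : r ≤ R) :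
    0 < 1 - κ * r ^ 2 := by
  linarith [(abs_lt.1 (abs_kappa_mul_sq_lt_one hκ h0 hr)).2]

lemma hasFDerivAt_conformalFactor {κ : ℝ} {z : ℂ} (hz : 1 + κ * ‖z‖ ^ 2 ≠ 0) :
    HasFDerivAt (fun x : ℂ => ((1 + κ * ‖x‖ ^ 2) ^ 2)⁻¹)
      ((-(4 * κ) / (1 + κ * ‖z‖ ^ 2) ^ 3) • innerSL ℝ z) z := by
  have h1 : HasFDerivAt (fun x : ℂ => 1 + κ * ‖x‖ ^ 2) (κ • (2 • innerSL ℝ z)) z :=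
    ((hasStrictFDerivAt_norm_sq z).hasFDerivAt.const_mul κ).const_add 1
  have h2 : HasDerivAt (fun y : ℝ => (y ^ 2)⁻¹) (-(2 * (1 + κ * ‖z‖ ^ 2)) /
      ((1 + κ * ‖z‖ ^ 2) ^ 2) ^ 2) (1 + κ * ‖z‖ ^ 2) := by
    simpa using HasDerivAt.fun_inv (c := fun y : ℝ => y ^ 2) (hasDerivAt_pow 2 _) (pow_ne_zero 2 hz)
  refine (h2.comp_hasFDerivAt z h1).congr_fderiv ?_
  rw [smul_smul, ← Nat.cast_smul_eq_nsmul ℝ, smul_smul]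
  congr 1
  field_simp
  ring

lemma partialDeriv_metric {κ : ℝ} {z : ℂ} (hz : 1 + κ * ‖z‖ ^ 2 ≠ 0) (i j l : Fin 2) :
    partialDeriv i (fun x => metric κ x j l) z =
      -(4 * κ) / (1 + κ * ‖z‖ ^ 2) ^ 3 * coord z i * (1 : Matrix (Fin 2) (Fin 2) ℝ) j l := by
  have h := (hasFDerivAt_conformalFactor hz).mul_const ((1 : Matrix (Fin 2) (Fin 2) ℝ) j l)
  have h' : HasFDerivAt (fun x => metric κ x j l) _ z := h
  rw [partialDeriv, h'.fderiv]
  fin_cases i <;> simp [coordVec, coord, Complex.inner] <;> ring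

lemma metric_inv {κ : ℝ} {z : ℂ} (hz : 1 + κ * ‖z‖ ^ 2 ≠ 0) :
    (metric κ z)⁻¹ = (1 + κ * ‖z‖ ^ 2) ^ 2 • (1 : Matrix (Fin 2) (Fin 2) ℝ) := by
  apply Matrix.inv_eq_left_inv
  rw [metric, smul_mul_smul_comm, mul_inv_cancel₀ (pow_ne_zero 2 hz), one_smul, one_mul]

/-- For a conformal metric `e^{2φ}|dz|²` the geodesic equation is `z'' = -2 (∂_z φ) z'²` in complex
form. Here `φ = -log(1 + κ|z|²)`, with `∂_z φ = -κ z̄ / (1 + κ|z|²)`. -/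
lemma geodesicAccel_eq {κ : ℝ} {z : ℂ} (hz : 1 + κ * ‖z‖ ^ 2 ≠ 0) (v : ℂ) :
    geodesicAccel κ z v = 2 * κ * conj z * v ^ 2 / ((1 + κ * ‖z‖ ^ 2 : ℝ) : ℂ) := by
  rw [eq_div_iff (by exact_mod_cast hz)]
  apply Complex.ext <;>
  simp [geodesicAccel, christoffel, partialDeriv_metric hz, metric_inv hz, Fin.sum_univ_two,
    Complex.mul_re, Complex.mul_im, coord, pow_two] <;> field_simp <;> ring

/-- The autonomous first order system of the geodesic equation is Lipschitz on compact sets. -/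
lemma exists_lipschitzOnWith_geodesicField {κ R : ℝ} (hκ : R ^ 2 * |κ| < 1) (M : ℝ) :
    ∃ K, LipschitzOnWith K (fun x : ℂ × ℂ => (x.2, geodesicAccel κ x.1 x.2))
      (closedBall 0 R ×ˢ closedBall 0 M) := by
  have hpos : ∀ x ∈ (closedBall (0 : ℂ) R ×ˢ closedBall (0 : ℂ) M), 1 + κ * ‖x.1‖ ^ 2 ≠ 0 :=
    fun x hx => (one_add_pos hκ (norm_nonneg _) (by simpa using hx.1)).ne'
  have hc : ContDiffOn ℝ 1 (fun x : ℂ × ℂ => (x.2, geodesicAccel κ x.1 x.2))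
      (closedBall 0 R ×ˢ closedBall 0 M) := by
    have : ContDiffOn ℝ 1 (fun x : ℂ × ℂ => (x.2, 2 * κ * conj x.1 * x.2 ^ 2 *
        (((1 + κ * ‖x.1‖ ^ 2)⁻¹ : ℝ) : ℂ))) (closedBall 0 R ×ˢ closedBall 0 M) := by
      refine contDiffOn_snd.prodMk (ContDiffOn.mul ?_ ?_)
      · have : ContDiff ℝ 1 (fun x : ℂ × ℂ => conj x.1) :=
          Complex.conjCLE.contDiff.comp contDiff_fst
        exact ((contDiff_const.mul this).mul (contDiff_snd.pow 2)).contDiffOn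
      · refine Complex.ofRealCLM.contDiff.comp_contDiffOn (ContDiffOn.inv ?_ hpos)
        exact (contDiff_const.add (contDiff_const.mul (contDiff_fst.norm_sq ℝ))).contDiffOn
    refine this.congr fun x hx => ?_
    simp only [geodesicAccel_eq (hpos x hx), div_eq_mul_inv, Complex.ofReal_inv]
  exact hc.exists_lipschitzOnWith one_ne_zero
    ((convex_closedBall _ _).prod (convex_closedBall _ _))
    ((isCompact_closedBall _ _).prod (isCompact_closedBall _ _))

/-! ### Uniqueness of the geodesic and of its exit time -/

lemma IsChord.norm_le {κ R : ℝ} (hR : 0 < R) {p : AddCircle (2 * π) × ℝ} {c : ℝ × (ℝ → ℂ)}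
    (h : IsChord κ R p c) {t : ℝ} (ht : t ∈ Icc 0 c.1) : ‖c.2 t‖ ≤ R := by
  obtain ⟨h0, ⟨v, hz, -, -⟩, hin, hend⟩ := h
  rcases ht.1.eq_or_lt with rfl | h1
  · rw [hz, norm_mul, cis, Circle.norm_coe, mul_one, Complex.norm_real, Real.norm_of_nonneg hR.le]
  rcases ht.2.eq_or_lt with rfl | h2
  · exact hend.le
  · exact (hin t ⟨h1, h2⟩).le

lemma IsChord.eqOn_of_le {κ R : ℝ} (hR : 0 < R) (hκ : R ^ 2 * |κ| < 1)
    {p : AddCircle (2 * π) × ℝ} {c d : ℝ × (ℝ → ℂ)} (hc : IsChord κ R p c) (hd : IsChord κ R p d)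
    (hle : c.1 ≤ d.1) : EqOn c.2 d.2 (Icc 0 c.1) := by
  have hcn := fun t ht => hc.norm_le hR (t := t) ht
  have hdn := fun t ht => hd.norm_le hR (t := t) ht
  obtain ⟨-, ⟨v, hz, hv, hode⟩, -, -⟩ := hc
  obtain ⟨-, ⟨u, hz', hu, hode'⟩, -, -⟩ := hd
  have hsub : Icc 0 c.1 ⊆ Icc 0 d.1 := Icc_subset_Icc_right hle
  have hvc : ContinuousOn v (Icc 0 c.1) := fun t ht => (hode t ht).2.continuousWithinAt
  have huc : ContinuousOn u (Icc 0 c.1) :=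
    fun t ht => ((hode' t (hsub ht)).2.mono hsub).continuousWithinAt
  -- The geodesic field is quadratic in the velocity, hence only locally Lipschitz. Bounding both
  -- velocities on the compact interval confines the two solutions to one compact convex set.
  obtain ⟨M₁, hM₁⟩ := isCompact_Icc.exists_bound_of_continuousOn hvc
  obtain ⟨M₂, hM₂⟩ := isCompact_Icc.exists_bound_of_continuousOn huc
  obtain ⟨K, hK⟩ := exists_lipschitzOnWith_geodesicField hκ (max M₁ M₂)
  have hpair : ∀ t ∈ Icc 0 c.1, HasDerivWithinAt (fun t => (c.2 t, v t))
      (v t, geodesicAccel κ (c.2 t) (v t)) (Icc 0 c.1) t :=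
    fun t ht => (hode t ht).1.prodMk (hode t ht).2
  have hpair' : ∀ t ∈ Icc 0 c.1, HasDerivWithinAt (fun t => (d.2 t, u t))
      (u t, geodesicAccel κ (d.2 t) (u t)) (Icc 0 c.1) t :=
    fun t ht => ((hode' t (hsub ht)).1.mono hsub).prodMk ((hode' t (hsub ht)).2.mono hsub)
  have hIci : ∀ t ∈ Ico 0 c.1, Icc 0 c.1 ∈ nhdsWithin t (Ici t) := fun t ht =>
    Filter.mem_of_superset (Icc_mem_nhdsGE ht.2) (Icc_subset_Icc_left ht.1)
  have key := ODE_solution_unique_of_mem_Icc_right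
    (v := fun _ x => (x.2, geodesicAccel κ x.1 x.2))
    (s := fun _ => closedBall (0 : ℂ) R ×ˢ closedBall (0 : ℂ) (max M₁ M₂))
    (f := fun t => (c.2 t, v t)) (g := fun t => (d.2 t, u t)) (a := 0) (b := c.1) (K := K)
    (fun _ _ => hK) (fun t ht => (hpair t ht).continuousWithinAt)
    (fun t ht => (hpair t (Ico_subset_Icc_self ht)).mono_of_mem_nhdsWithin (hIci t ht))
    (fun t ht => ⟨by simpa using hcn t (Ico_subset_Icc_self ht),
      by simpa using Or.inl (hM₁ t (Ico_subset_Icc_self ht))⟩)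
    (fun t ht => (hpair' t ht).continuousWithinAt)
    (fun t ht => (hpair' t (Ico_subset_Icc_self ht)).mono_of_mem_nhdsWithin (hIci t ht))
    (fun t ht => ⟨by simpa using hdn t (hsub (Ico_subset_Icc_self ht)),
      by simpa using Or.inr (hM₂ t (Ico_subset_Icc_self ht))⟩)
    (by simp only [hz, hz', hv, hu])
  exact fun t ht => congrArg Prod.fst (key ht)

/-- If one exit time were smaller, the two curves would agree there, yet one would lie on the
boundary circle and the other strictly inside. -/
lemma IsChord.unique {κ R : ℝ} (hR : 0 < R) (hκ : R ^ 2 * |κ| < 1)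
    {p : AddCircle (2 * π) × ℝ} {c d : ℝ × (ℝ → ℂ)} (hc : IsChord κ R p c)
    (hd : IsChord κ R p d) : c.1 = d.1 ∧ EqOn c.2 d.2 (Icc 0 c.1) := by
  have aux : ∀ {c d : ℝ × (ℝ → ℂ)}, IsChord κ R p c → IsChord κ R p d → c.1 ≤ d.1 →
      c.1 = d.1 := by
    intro c d hc hd hle
    by_contra hne
    have h1 := hc.eqOn_of_le hR hκ hd hle (right_mem_Icc.2 hc.1.le)
    have h2 := hd.2.2.1 c.1 ⟨hc.1, lt_of_le_of_ne hle hne⟩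
    rw [← h1, hc.2.2.2] at h2
    exact lt_irrefl _ h2
  have heq : c.1 = d.1 := by
    rcases le_total c.1 d.1 with h | h
    · exact aux hc hd h
    · exact (aux hd hc h).symm
  exact ⟨heq, hc.eqOn_of_le hR hκ hd heq.le⟩

/-- Since `chord` is a mere choice, uniqueness is what lets the transform be computed along any
explicit chord. -/
lemma xray_eq_of_isChord {κ R : ℝ} (hR : 0 < R) (hκ : R ^ 2 * |κ| < 1)
    {p : AddCircle (2 * π) × ℝ} {c : ℝ × (ℝ → ℂ)} (hc : IsChord κ R p c) (f : ℂ → ℂ) :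
    xray κ R f p = ∫ t in (0 : ℝ)..c.1, f (c.2 t) := by
  obtain ⟨h1, h2⟩ := hc.unique hR hκ (Classical.epsilon_spec (p := IsChord κ R p) ⟨c, hc⟩)
  change c.1 = (chord κ R p).1 at h1
  change EqOn c.2 (chord κ R p).2 _ at h2
  rw [xray, ← h1]
  refine intervalIntegral.integral_congr fun t ht => ?_
  rw [uIcc_of_le hc.1.le] at ht
  exact congrArg f (h2 ht).symm

lemma intervalIntegrable_chord_iff {κ R : ℝ} (hR : 0 < R) (hκ : R ^ 2 * |κ| < 1)
    {p : AddCircle (2 * π) × ℝ} {c : ℝ × (ℝ → ℂ)} (hc : IsChord κ R p c) (f : ℂ → ℂ) :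
    IntervalIntegrable (fun t => f ((chord κ R p).2 t)) volume 0 (chord κ R p).1 ↔
      IntervalIntegrable (fun t => f (c.2 t)) volume 0 c.1 := by
  obtain ⟨h1, h2⟩ := hc.unique hR hκ (Classical.epsilon_spec (p := IsChord κ R p) ⟨c, hc⟩)
  change c.1 = (chord κ R p).1 at h1
  change EqOn c.2 (chord κ R p).2 _ at h2
  rw [← h1]
  refine intervalIntegrable_congr fun t ht => ?_
  rw [uIoc_of_le hc.1.le] at ht
  exact congrArg f (h2 (Ioc_subset_Icc_self ht)).symm

/-! ### Explicit geodesics -/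

lemma cis_coe (x : ℝ) : cis (x : AddCircle (2 * π)) = Complex.exp (x * Complex.I) := by
  rw [cis, AddCircle.toCircle_apply_mk, div_self Real.two_pi_pos.ne', one_mul, Circle.coe_exp]

lemma cis_add (x y : AddCircle (2 * π)) : cis (x + y) = cis x * cis y := by
  rw [cis, AddCircle.toCircle_add, Circle.coe_mul]; rfl

lemma norm_cis (x : AddCircle (2 * π)) : ‖cis x‖ = 1 := Circle.norm_coe _

lemma continuous_cis : Continuous cis :=
  continuous_subtype_val.comp AddCircle.continuous_toCircle

lemma cis_coe_eq (α : ℝ) : cis (α : AddCircle (2 * π)) = ⟨Real.cos α, Real.sin α⟩ := by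
  rw [cis_coe, Complex.exp_mul_I, ← Complex.ofReal_cos, ← Complex.ofReal_sin]
  apply Complex.ext <;> simp [Complex.cos_ofReal_re, Complex.sin_ofReal_re]

lemma cis_pi_add (α : ℝ) : cis ((π + α : ℝ) : AddCircle (2 * π)) = -cis (α : AddCircle (2 * π)) := by
  rw [cis_coe, cis_coe, Complex.ofReal_add, add_mul, Complex.exp_add, Complex.exp_pi_mul_I]
  ring

lemma cos_pos_of_mem_fibre {α : ℝ} (hα : α ∈ fibre) : 0 < Real.cos α := Real.cos_pos_of_mem_Ioo hα

/-- The geodesic issued from `(β, α)`, in the parameter `T = tan_κ(t)` which is the Euclidean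
distance to the origin after moving the starting point there by a `g_κ`-isometry. -/
def geo (κ R : ℝ) (p : AddCircle (2 * π) × ℝ) (T : ℝ) : ℂ :=
  cis p.1 * ((R - cis p.2 * T) / (1 + κ * R * cis p.2 * T))

/-- The value of the parameter `T` at the exit point. -/
def endParam (κ R α : ℝ) : ℝ := 2 * R * Real.cos α / (1 - κ * R ^ 2)

/-- The squared norm of the denominator of `geo`. -/
def geoDen (κ R α T : ℝ) : ℝ := 1 + 2 * κ * R * T * Real.cos α + κ ^ 2 * R ^ 2 * T ^ 2

section
variable {κ R : ℝ} (hR : 0 < R) (hκ : R ^ 2 * |κ| < 1)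
include hR hκ

lemma one_add_kR_pos : 0 < 1 + κ * R ^ 2 := one_add_pos hκ hR.le le_rfl

lemma one_sub_kR_pos : 0 < 1 - κ * R ^ 2 := one_sub_pos hκ hR.le le_rfl

lemma endParam_pos {α : ℝ} (hα : α ∈ fibre) : 0 < endParam κ R α := by
  have := one_sub_kR_pos hR hκ
  have := cos_pos_of_mem_fibre hα
  unfold endParam; positivity

lemma one_sub_mul_endParam (α : ℝ) : (1 - κ * R ^ 2) * endParam κ R α = 2 * R * Real.cos α := by
  have := one_sub_kR_pos hR hκ
  unfold endParam; field_simp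

lemma one_add_kappa_sq_pos {α T : ℝ} (hα : α ∈ fibre) (hT : T ∈ Icc 0 (endParam κ R α)) :
    0 < 1 + κ * T ^ 2 := by
  have h1 := one_sub_kR_pos hR hκ
  have h2 := one_add_kR_pos hR hκ
  have hc := cos_pos_of_mem_fibre hα
  rcases le_or_gt 0 κ with h | h
  · positivity
  have h3 : T ^ 2 ≤ endParam κ R α ^ 2 := pow_le_pow_left₀ hT.1 hT.2 2
  have h4 : (1 - κ * R ^ 2) ^ 2 * endParam κ R α ^ 2 = 4 * R ^ 2 * Real.cos α ^ 2 := by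
    rw [← mul_pow, one_sub_mul_endParam hR hκ]; ring
  have h5 : (1 - κ * R ^ 2) ^ 2 * T ^ 2 ≤ 4 * R ^ 2 := by
    have : Real.cos α ^ 2 ≤ 1 := Real.cos_sq_le_one α
    calc (1 - κ * R ^ 2) ^ 2 * T ^ 2 ≤ (1 - κ * R ^ 2) ^ 2 * endParam κ R α ^ 2 := by gcongr
      _ = 4 * R ^ 2 * Real.cos α ^ 2 := h4
      _ ≤ 4 * R ^ 2 * 1 := by gcongr
      _ = 4 * R ^ 2 := mul_one _
  -- For `κ < 0` the product is at least `(1 - κR²)² + 4κR² = (1 + κR²)²`.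
  have h6 : 0 < (1 - κ * R ^ 2) ^ 2 * (1 + κ * T ^ 2) := by nlinarith
  exact pos_of_mul_pos_right h6 (sq_nonneg _)

lemma geoDen_re_pos {α T : ℝ} (hα : α ∈ fibre) (hT : T ∈ Icc 0 (endParam κ R α)) :
    0 < 1 + κ * R * Real.cos α * T := by
  have h1 := one_sub_kR_pos hR hκ
  have h2 := one_add_kR_pos hR hκ
  have hc := cos_pos_of_mem_fibre hα
  have hT0 := hT.1
  rcases le_or_gt 0 κ with h | h
  · positivity
  have h5 : (1 - κ * R ^ 2) * (R * Real.cos α * T) ≤ 2 * R ^ 2 := by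
    have : Real.cos α ^ 2 ≤ 1 := Real.cos_sq_le_one α
    calc (1 - κ * R ^ 2) * (R * Real.cos α * T)
        ≤ (1 - κ * R ^ 2) * (R * Real.cos α * endParam κ R α) := by gcongr; exact hT.2
      _ = R * Real.cos α * ((1 - κ * R ^ 2) * endParam κ R α) := by ring
      _ = 2 * R ^ 2 * Real.cos α ^ 2 := by rw [one_sub_mul_endParam hR hκ]; ring
      _ ≤ 2 * R ^ 2 * 1 := by gcongr
      _ = 2 * R ^ 2 := mul_one _
  -- For `κ < 0` the product is at least `1 - κR² + 2κR² = 1 + κR²`.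
  have h6 : 0 < (1 - κ * R ^ 2) * (1 + κ * R * Real.cos α * T) := by nlinarith
  exact pos_of_mul_pos_right h6 h1.le

lemma geo_den_ne_zero {α T : ℝ} (hα : α ∈ fibre) (hT : T ∈ Icc 0 (endParam κ R α)) :
    (1 + κ * R * cis α * T : ℂ) ≠ 0 := by
  intro h
  have := congrArg Complex.re h
  simp [cis_coe_eq] at this
  exact (geoDen_re_pos hR hκ hα hT).ne' this

omit hR hκ in
lemma geoDen_eq (α T : ℝ) : geoDen κ R α T = Complex.normSq (1 + κ * R * cis α * T) := by
  have := Real.sin_sq_add_cos_sq α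
  simp [geoDen, Complex.normSq_apply, cis_coe_eq]
  linear_combination (-κ ^ 2 * R ^ 2 * T ^ 2) * this

lemma geoDen_pos {α T : ℝ} (hα : α ∈ fibre) (hT : T ∈ Icc 0 (endParam κ R α)) :
    0 < geoDen κ R α T := by
  rw [geoDen_eq]; exact Complex.normSq_pos.2 (geo_den_ne_zero hR hκ hα hT)

omit hR hκ in
lemma norm_geo_sq (p : AddCircle (2 * π) × ℝ) (T : ℝ) :
    ‖geo κ R p T‖ ^ 2 = (R ^ 2 - 2 * R * T * Real.cos p.2 + T ^ 2) / geoDen κ R p.2 T := by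
  have := Real.sin_sq_add_cos_sq p.2
  rw [geo, norm_mul, norm_cis, one_mul, norm_div, div_pow, Complex.sq_norm, Complex.sq_norm,
    ← geoDen_eq]
  congr 1
  simp [Complex.normSq_apply, cis_coe_eq]
  linear_combination T ^ 2 * this

omit hR hκ in
lemma conj_cis_mul (x : AddCircle (2 * π)) : cis x * conj (cis x) = 1 := by
  rw [Complex.mul_conj, Complex.normSq_eq_norm_sq, norm_cis]; simp

omit hR hκ in
lemma ofReal_geoDen (α T : ℝ) : (geoDen κ R α T : ℂ) =
    (1 + κ * R * cis α * T) * conj (1 + κ * R * cis α * T : ℂ) := by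
  rw [Complex.mul_conj, geoDen_eq]

omit hR hκ in
lemma conj_geo (p : AddCircle (2 * π) × ℝ) (T : ℝ) : conj (geo κ R p T) =
    conj (cis p.1) * ((R - conj (cis p.2) * T) / conj (1 + κ * R * cis p.2 * T : ℂ)) := by
  simp [geo]

omit hR hκ in
-- The geodesic equation for `geo` as an identity of rational functions. Primed letters stand for
-- complex conjugates; of conjugation only `a a' = b b' = 1` is needed.
lemma accel_identity {a a' b b' r k T D D' : ℂ} (ha : a * a' = 1) (hb : b * b' = 1)
    (hD : D = 1 + k * r * a * T) (hD0 : D ≠ 0) (hD0' : D' ≠ 0) (hk : 1 + k * r ^ 2 ≠ 0)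
    (hT : 1 + k * T ^ 2 ≠ 0) :
    (-b * a * (1 + k * r ^ 2) * (k * (2 * T * (1 + k * T ^ 2))) * D ^ 2 -
      -b * a * (1 + k * r ^ 2) * (1 + k * T ^ 2) * (2 * D * (k * r * a * (1 + k * T ^ 2)))) /
      (D ^ 2) ^ 2 =
    2 * k * (b' * ((r - a' * T) / D')) * (-b * a * (1 + k * r ^ 2) * (1 + k * T ^ 2) / D ^ 2) ^ 2 /
      ((1 + k * r ^ 2) * (1 + k * T ^ 2) / (D * D')) := by
  field_simp
  subst hD
  linear_combination (b * a * k * T * b * b') * ha + (b * a * k * T - b * a ^ 2 * k * r) * hb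

variable {p : AddCircle (2 * π) × ℝ} (hp : p.2 ∈ fibre)
include hp

lemma one_add_kappa_norm_geo_sq {T : ℝ} (hT : T ∈ Icc 0 (endParam κ R p.2)) :
    1 + κ * ‖geo κ R p T‖ ^ 2 = (1 + κ * R ^ 2) * (1 + κ * T ^ 2) / geoDen κ R p.2 T := by
  have := geoDen_pos hR hκ hp hT
  rw [norm_geo_sq, eq_div_iff this.ne', add_mul, mul_assoc, div_mul_cancel₀ _ this.ne', geoDen]
  ring

lemma one_sub_kappa_norm_geo_sq {T : ℝ} (hT : T ∈ Icc 0 (endParam κ R p.2)) :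
    1 - κ * ‖geo κ R p T‖ ^ 2 = ((1 - κ * R ^ 2) + 4 * κ * R * Real.cos p.2 * T
      - κ * (1 - κ * R ^ 2) * T ^ 2) / geoDen κ R p.2 T := by
  have := geoDen_pos hR hκ hp hT
  rw [norm_geo_sq, eq_div_iff this.ne', sub_mul, mul_assoc, div_mul_cancel₀ _ this.ne', geoDen]
  ring

/-- The factorization, with zeros exactly at `T = 0` and `T = endParam`, identifies the exit point
and shows that the curve is inside in between. -/
lemma sq_sub_norm_geo_sq {T : ℝ} (hT : T ∈ Icc 0 (endParam κ R p.2)) :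
    R ^ 2 - ‖geo κ R p T‖ ^ 2 =
      T * (1 + κ * R ^ 2) * ((1 - κ * R ^ 2) * (endParam κ R p.2 - T)) / geoDen κ R p.2 T := by
  have := geoDen_pos hR hκ hp hT
  rw [norm_geo_sq, eq_div_iff this.ne', sub_mul, div_mul_cancel₀ _ this.ne', mul_sub,
    one_sub_mul_endParam hR hκ, geoDen]
  ring

lemma norm_geo_lt {T : ℝ} (hT : T ∈ Ioo 0 (endParam κ R p.2)) : ‖geo κ R p T‖ < R := by
  have h1 := sq_sub_norm_geo_sq hR hκ hp (Ioo_subset_Icc_self hT)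
  have h2 := geoDen_pos hR hκ hp (Ioo_subset_Icc_self hT)
  have h3 : 0 < R ^ 2 - ‖geo κ R p T‖ ^ 2 := by
    rw [h1]
    have := one_sub_kR_pos hR hκ
    have := one_add_kR_pos hR hκ
    have := sub_pos.2 hT.2
    have := hT.1
    positivity
  exact lt_of_pow_lt_pow_left₀ 2 hR.le (by linarith)

lemma norm_geo_end : ‖geo κ R p (endParam κ R p.2)‖ = R := by
  have h1 := sq_sub_norm_geo_sq hR hκ hp (right_mem_Icc.2 (endParam_pos hR hκ hp).le)
  rw [sub_self, mul_zero, mul_zero, zero_div, sub_eq_zero] at h1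
  exact (pow_left_inj₀ (norm_nonneg _) hR.le two_ne_zero).1 h1.symm

/-- The time change enters only through the equation `T' = 1 + κT²`, so no case split between `tan`,
the identity and `tanh` is needed. -/
lemma isChord_geo {τ : ℝ} {T : ℝ → ℝ} (hτ : 0 < τ) (h0 : T 0 = 0) (hend : T τ = endParam κ R p.2)
    (hmem : ∀ t ∈ Ioo 0 τ, T t ∈ Ioo 0 (endParam κ R p.2))
    (hT : ∀ t ∈ Icc 0 τ, HasDerivWithinAt T (1 + κ * T t ^ 2) (Icc 0 τ) t) :
    IsChord κ R p (τ, fun t => geo κ R p (T t)) := by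
  have hend_pos := endParam_pos hR hκ hp
  have hmem' : ∀ t ∈ Icc 0 τ, T t ∈ Icc 0 (endParam κ R p.2) := by
    intro t ht
    rcases ht.1.eq_or_lt with rfl | h1
    · simp [h0, hend_pos.le]
    rcases ht.2.eq_or_lt with rfl | h2
    · simp [hend, hend_pos.le]
    · exact Ioo_subset_Icc_self (hmem t ⟨h1, h2⟩)
  -- The velocity witness is the derivative of the Möbius map in `T`, `-e^{i(β+α)}(1 + κR²)/(1 + κR
  -- e^{iα}T)²`, times `T'`.
  refine ⟨hτ, ⟨fun t => -cis p.1 * cis p.2 * (1 + κ * R ^ 2) * (1 + κ * T t ^ 2) /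
    (1 + κ * R * cis p.2 * T t) ^ 2, ?_, ?_, fun t ht => ?_⟩, fun t ht => ?_, ?_⟩
  · simp [geo, h0]; ring
  · simp only [h0]; rw [cis_add, cis_pi_add]; push_cast; ring
  · have hD := geo_den_ne_zero hR hκ hp (hmem' t ht)
    have h1 := (hT t ht).ofReal_comp
    have hnum : HasDerivWithinAt (fun t => (R - cis p.2 * T t : ℂ))
        (-(cis p.2 * (1 + κ * T t ^ 2 : ℝ))) (Icc 0 τ) t := (h1.const_mul _).const_sub _
    have hden : HasDerivWithinAt (fun t => (1 + κ * R * cis p.2 * T t : ℂ))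
        (κ * R * cis p.2 * (1 + κ * T t ^ 2 : ℝ)) (Icc 0 τ) t := (h1.const_mul _).const_add _
    constructor
    · refine ((hnum.div hden hD).const_mul (cis p.1)).congr_deriv ?_
      rw [mul_div_assoc', div_left_inj' (pow_ne_zero 2 hD)]
      push_cast
      ring
    · have hw : HasDerivWithinAt (fun t => (1 + κ * T t ^ 2 : ℂ))
          (κ * (2 * T t * (1 + κ * T t ^ 2 : ℝ))) (Icc 0 τ) t := by
        simpa using ((h1.fun_pow 2).const_mul (κ : ℂ)).const_add 1
      refine ((hw.const_mul (-cis p.1 * cis p.2 * (1 + κ * R ^ 2))).div (hden.fun_pow 2)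
        (pow_ne_zero 2 hD)).congr_deriv ?_
      have hk := one_add_kappa_norm_geo_sq hR hκ hp (hmem' t ht)
      have hkR := one_add_kR_pos hR hκ
      have hkT := one_add_kappa_sq_pos hR hκ hp (hmem' t ht)
      have hden_pos := geoDen_pos hR hκ hp (hmem' t ht)
      rw [geodesicAccel_eq (by rw [hk]; positivity), hk]
      push_cast
      rw [ofReal_geoDen, conj_geo, pow_one]
      refine accel_identity (conj_cis_mul _) (conj_cis_mul _) rfl hD
        ((map_ne_zero (starRingEnd ℂ)).2 hD) (by exact_mod_cast hkR.ne') (by exact_mod_cast hkT.ne')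
  · exact norm_geo_lt hR hκ hp (hmem t ht)
  · simp only [hend]; exact norm_geo_end hR hκ hp

end

/-! ### The time change along a geodesic -/

/-- Separation of variables: `T` is the inverse of `θ(x) = ∫₀ˣ dy / h(y)`. The upper bound on `h`
makes `θ` grow at least linearly, hence onto, and so the solution is global. -/
lemma exists_flow_of_pos_of_le {h : ℝ → ℝ} (hc : Continuous h) {m M : ℝ} (hm : 0 < m)
    (hmh : ∀ x, m ≤ h x) (hhM : ∀ x, h x ≤ M) :
    ∃ T : ℝ → ℝ, T 0 = 0 ∧ StrictMono T ∧ Function.Surjective T ∧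
      ∀ t, HasDerivAt T (h (T t)) t := by
  have hpos : ∀ x, 0 < h x := fun x => hm.trans_le (hmh x)
  have hM : 0 < M := (hpos 0).trans_le (hhM 0)
  have hic : Continuous fun x => (h x)⁻¹ := hc.inv₀ fun x => (hpos x).ne'
  set θ : ℝ → ℝ := fun x => ∫ y in (0 : ℝ)..x, (h y)⁻¹
  have hθ : ∀ x, HasDerivAt θ (h x)⁻¹ x := fun x =>
    intervalIntegral.integral_hasDerivAt_right (hic.intervalIntegrable _ _)
      hic.stronglyMeasurable.stronglyMeasurableAtFilter hic.continuousAt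
  have hmono : StrictMono θ := strictMono_of_hasDerivAt_pos hθ fun x => inv_pos.2 (hpos x)
  have hθc : Continuous θ := continuous_iff_continuousAt.2 fun x => (hθ x).continuousAt
  have hθ0 : θ 0 = 0 := intervalIntegral.integral_same
  have hlin : Monotone fun x => θ x - M⁻¹ * x := by
    have hd : ∀ x, HasDerivAt (fun x => θ x - M⁻¹ * x) ((h x)⁻¹ - M⁻¹) x := fun x => by
      simpa using (hθ x).fun_sub ((hasDerivAt_id x).const_mul M⁻¹)
    refine monotone_of_deriv_nonneg (fun x => (hd x).differentiableAt) fun x => ?_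
    rw [(hd x).deriv, sub_nonneg]
    exact inv_anti₀ (hpos x) (hhM x)
  have hsurj : Function.Surjective θ := by
    refine hθc.surjective ?_ ?_
    · refine Filter.tendsto_atTop_mono' _ ?_ (Filter.tendsto_id.const_mul_atTop (inv_pos.2 hM))
      filter_upwards [Filter.eventually_ge_atTop 0] with x hx
      have := hlin hx
      simp only [hθ0, mul_zero, sub_zero, id] at this ⊢
      linarith
    · refine Filter.tendsto_atBot_mono' _ ?_ (Filter.tendsto_id.const_mul_atBot (inv_pos.2 hM))
      filter_upwards [Filter.eventually_le_atBot 0] with x hx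
      have := hlin hx
      simp only [hθ0, mul_zero, sub_zero, id] at this ⊢
      linarith
  set e := hmono.orderIsoOfSurjective θ hsurj
  have he : ∀ t, θ (e.symm t) = t := fun t => e.apply_symm_apply t
  refine ⟨e.symm, ?_, e.symm.strictMono, e.symm.surjective, fun t => ?_⟩
  · rw [OrderIso.symm_apply_eq]; exact hθ0.symm
  · have := HasDerivAt.of_local_left_inverse (f := θ) (g := e.symm) e.symm.continuous.continuousAt
      (hθ (e.symm t)) (inv_ne_zero (hpos _).ne') (Filter.Eventually.of_forall he)
    simpa using this

section
variable {κ R : ℝ} (hR : 0 < R) (hκ : R ^ 2 * |κ| < 1)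
include hR hκ

lemma exists_timeChange {α : ℝ} (hα : α ∈ fibre) : ∃ (τ : ℝ) (T : ℝ → ℝ), 0 < τ ∧ T 0 = 0 ∧
    T τ = endParam κ R α ∧ StrictMono T ∧
    ∀ t ∈ Icc 0 τ, HasDerivWithinAt T (1 + κ * T t ^ 2) (Icc 0 τ) t := by
  set E := endParam κ R α
  have hE : 0 < E := endParam_pos hR hκ hα
  have hcl : ∀ x : ℝ, max 0 (min x E) ∈ Icc 0 E := fun x =>
    ⟨le_max_left _ _, max_le hE.le (min_le_right _ _)⟩
  have hE2 := one_add_kappa_sq_pos hR hκ hα (right_mem_Icc.2 hE.le)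
  -- Clamping `x` to `[0, E]` makes the field positive and bounded on the whole line. The clamp is
  -- inactive for times in `[0, τ]`.
  obtain ⟨T, h0, hmono, hsurj, hT⟩ := exists_flow_of_pos_of_le
    (h := fun x => 1 + κ * max 0 (min x E) ^ 2) (m := min 1 (1 + κ * E ^ 2)) (M := 1 + |κ| * E ^ 2)
    (by fun_prop) (lt_min one_pos hE2)
    (fun x => by
      have h1 : max 0 (min x E) ^ 2 ≤ E ^ 2 := pow_le_pow_left₀ (hcl x).1 (hcl x).2 2
      rcases le_total 0 κ with h | h
      · exact (min_le_left _ _).trans (le_add_of_nonneg_right (by positivity))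
      · exact (min_le_right _ _).trans (by nlinarith))
    (fun x => by
      have h1 : max 0 (min x E) ^ 2 ≤ E ^ 2 := pow_le_pow_left₀ (hcl x).1 (hcl x).2 2
      have := le_abs_self κ
      gcongr)
  obtain ⟨τ, hτ⟩ := hsurj E
  refine ⟨τ, T, ?_, h0, hτ, hmono, fun t ht => ?_⟩
  · rwa [← hmono.lt_iff_lt, h0, hτ]
  · have h1 : 0 ≤ T t := h0 ▸ hmono.monotone ht.1
    have h2 : T t ≤ E := hτ ▸ hmono.monotone ht.2
    have := (hT t).hasDerivWithinAt (s := Icc 0 τ)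
    rwa [min_eq_left h2, max_eq_right h1] at this

lemma exists_isChord_geo {p : AddCircle (2 * π) × ℝ} (hp : p.2 ∈ fibre) :
    ∃ (τ : ℝ) (T : ℝ → ℝ), 0 < τ ∧ T 0 = 0 ∧ T τ = endParam κ R p.2 ∧ StrictMono T ∧
      (∀ t ∈ Icc 0 τ, HasDerivWithinAt T (1 + κ * T t ^ 2) (Icc 0 τ) t) ∧
      IsChord κ R p (τ, fun t => geo κ R p (T t)) := by
  obtain ⟨τ, T, hτ, h0, hend, hmono, hT⟩ := exists_timeChange hR hκ hp
  refine ⟨τ, T, hτ, h0, hend, hmono, hT, isChord_geo hR hκ hp hτ h0 hend (fun t ht => ?_) hT⟩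
  exact ⟨h0 ▸ hmono ht.1, hend ▸ hmono ht.2⟩

lemma isChord_chord {p : AddCircle (2 * π) × ℝ} (hp : p.2 ∈ fibre) :
    IsChord κ R p (chord κ R p) := by
  obtain ⟨τ, T, -, -, -, -, -, h⟩ := exists_isChord_geo hR hκ hp
  exact Classical.epsilon_spec (p := IsChord κ R p) ⟨_, h⟩

end

/-- The Euclidean chord of the unit disk. -/
def line (p : AddCircle (2 * π) × ℝ) (S : ℝ) : ℂ := cis p.1 * (1 - cis p.2 * S)

lemma isChord_line {p : AddCircle (2 * π) × ℝ} (hp : p.2 ∈ fibre) :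
    IsChord 0 1 p (2 * Real.cos p.2, line p) := by
  have hE : endParam 0 1 p.2 = 2 * Real.cos p.2 := by simp [endParam]
  have hc := cos_pos_of_mem_fibre hp
  have hl : line p = fun t => geo 0 1 p (id t) := by ext t; simp [line, geo]
  rw [hl]
  refine isChord_geo one_pos (by simp) hp (by positivity) rfl hE.symm (fun t ht => hE ▸ ht) ?_
  intro t _
  simpa using hasDerivWithinAt_id t _

/-! ### The fibre map `s` -/

lemma sMap_mem_fibre (κ R α : ℝ) : sMap κ R α ∈ fibre := Real.arctan_mem_Ioo _

/-- `√((1 + κR²)² cos² α + (1 - κR²)² sin² α)`. -/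
def fibreNorm (κ R α : ℝ) : ℝ :=
  Real.sqrt ((1 + κ * R ^ 2) ^ 2 * Real.cos α ^ 2 + (1 - κ * R ^ 2) ^ 2 * Real.sin α ^ 2)

section
variable {κ R : ℝ} (hR : 0 < R) (hκ : R ^ 2 * |κ| < 1)
include hR hκ

lemma fibreNorm_arg_pos (α : ℝ) :
    0 < (1 + κ * R ^ 2) ^ 2 * Real.cos α ^ 2 + (1 - κ * R ^ 2) ^ 2 * Real.sin α ^ 2 := by
  have h1 := one_sub_kR_pos hR hκ
  have h2 := one_add_kR_pos hR hκ
  rcases eq_or_ne (Real.cos α) 0 with h | h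
  · have : Real.sin α ^ 2 = 1 := by rw [Real.sin_sq, h]; norm_num
    rw [h, this]; positivity
  · positivity

lemma fibreNorm_pos (α : ℝ) : 0 < fibreNorm κ R α := Real.sqrt_pos.2 (fibreNorm_arg_pos hR hκ α)

lemma fibreNorm_sq (α : ℝ) : fibreNorm κ R α ^ 2 =
    (1 + κ * R ^ 2) ^ 2 * Real.cos α ^ 2 + (1 - κ * R ^ 2) ^ 2 * Real.sin α ^ 2 :=
  Real.sq_sqrt (fibreNorm_arg_pos hR hκ α).le

lemma sqrt_one_add_sMap {α : ℝ} (hα : α ∈ fibre) :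
    Real.sqrt (1 + ((1 - κ * R ^ 2) / (1 + κ * R ^ 2) * Real.tan α) ^ 2) =
      fibreNorm κ R α / ((1 + κ * R ^ 2) * Real.cos α) := by
  have h2 := one_add_kR_pos hR hκ
  have hc := cos_pos_of_mem_fibre hα
  have hm := fibreNorm_pos hR hκ α
  rw [Real.sqrt_eq_iff_mul_self_eq (by positivity) (by positivity), Real.tan_eq_sin_div_cos,
    ← pow_two, div_pow, fibreNorm_sq hR hκ]
  field_simp

lemma cos_sMap {α : ℝ} (hα : α ∈ fibre) :
    Real.cos (sMap κ R α) = (1 + κ * R ^ 2) * Real.cos α / fibreNorm κ R α := by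
  rw [sMap, Real.cos_arctan, sqrt_one_add_sMap hR hκ hα, one_div_div]

lemma sin_sMap {α : ℝ} (hα : α ∈ fibre) :
    Real.sin (sMap κ R α) = (1 - κ * R ^ 2) * Real.sin α / fibreNorm κ R α := by
  have h2 := one_add_kR_pos hR hκ
  have hc := cos_pos_of_mem_fibre hα
  have hm := fibreNorm_pos hR hκ α
  rw [sMap, Real.sin_arctan, sqrt_one_add_sMap hR hκ hα, Real.tan_eq_sin_div_cos]
  field_simp

lemma hasDerivAt_sMap {α : ℝ} (hα : α ∈ fibre) :
    HasDerivAt (sMap κ R) ((1 - κ * R ^ 2) * (1 + κ * R ^ 2) / fibreNorm κ R α ^ 2) α := by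
  have h2 := one_add_kR_pos hR hκ
  have hc := cos_pos_of_mem_fibre hα
  have hm := fibreNorm_arg_pos hR hκ α
  have h := ((Real.hasDerivAt_tan hc.ne').const_mul ((1 - κ * R ^ 2) / (1 + κ * R ^ 2))).arctan
  refine h.congr_deriv ?_
  rw [fibreNorm_sq hR hκ, Real.tan_eq_sin_div_cos]
  field_simp

lemma sqrt_deriv_sMap {α : ℝ} (hα : α ∈ fibre) : Real.sqrt (deriv (sMap κ R) α) =
    Real.sqrt (1 - κ * R ^ 2) * Real.sqrt (1 + κ * R ^ 2) / fibreNorm κ R α := by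
  rw [(hasDerivAt_sMap hR hκ hα).deriv, Real.sqrt_div' _ (sq_nonneg _),
    Real.sqrt_sq (fibreNorm_pos hR hκ α).le, Real.sqrt_mul (one_sub_kR_pos hR hκ).le]

lemma dualConst_eq : dualConst κ R = (1 - κ * R ^ 2) * Real.sqrt (1 - κ * R ^ 2) /
    (R * Real.sqrt (1 + κ * R ^ 2)) := by
  have h1 := one_sub_kR_pos hR hκ
  rw [dualConst, ← Real.sqrt_eq_rpow, show (3 / 2 : ℝ) = 1 + 1 / 2 by norm_num,
    Real.rpow_add h1, Real.rpow_one, ← Real.sqrt_eq_rpow]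

lemma dualConst_pos : 0 < dualConst κ R := by
  have h1 := one_sub_kR_pos hR hκ
  have h2 := one_add_kR_pos hR hκ
  rw [dualConst_eq hR hκ]; positivity

lemma dualConst_mul_inv_sqrt {α : ℝ} (hα : α ∈ fibre) :
    dualConst κ R * (Real.sqrt (deriv (sMap κ R) α))⁻¹ =
      fibreNorm κ R α * (1 - κ * R ^ 2) / (R * (1 + κ * R ^ 2)) := by
  have h1 := one_sub_kR_pos hR hκ
  have h2 := one_add_kR_pos hR hκ
  have hm := fibreNorm_pos hR hκ α
  rw [dualConst_eq hR hκ, sqrt_deriv_sMap hR hκ hα]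
  have h4 := Real.sq_sqrt h2.le
  have h5 := Real.sqrt_pos.2 h1
  have h6 := Real.sqrt_pos.2 h2
  field_simp
  rw [h4]

/-- Changing the sign of `κ` swaps `1 - κR²` and `1 + κR²`, hence inverts the factor in front of
`tan`. -/
lemma sMap_neg_sMap {α : ℝ} (hα : α ∈ fibre) : sMap (-κ) R (sMap κ R α) = α := by
  have h1 := (one_sub_kR_pos hR hκ).ne'
  have h2 := (one_add_kR_pos hR hκ).ne'
  rw [sMap, sMap, Real.tan_arctan, neg_mul, sub_neg_eq_add, ← sub_eq_add_neg, ← mul_assoc,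
    div_mul_div_cancel₀ h1, div_self h2, one_mul, Real.arctan_tan hα.1 hα.2]

lemma sMap_sMap_neg {α : ℝ} (hα : α ∈ fibre) : sMap κ R (sMap (-κ) R α) = α := by
  simpa using sMap_neg_sMap (κ := -κ) hR (by simpa using hκ) hα

lemma bijOn_sMap : BijOn (sMap κ R) fibre fibre :=
  InvOn.bijOn ⟨fun _ h => sMap_neg_sMap hR hκ h, fun _ h => sMap_sMap_neg hR hκ h⟩
    (fun _ _ => sMap_mem_fibre _ _ _) (fun _ _ => sMap_mem_fibre _ _ _)

lemma sInv_eq {α : ℝ} (hα : α ∈ fibre) : sInv κ R α = sMap (-κ) R α := by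
  refine (bijOn_sMap hR hκ).injOn ((bijOn_sMap hR hκ).surjOn.mapsTo_invFunOn hα)
    (sMap_mem_fibre _ _ _) ?_
  rw [sMap_sMap_neg hR hκ hα]
  exact (bijOn_sMap hR hκ).surjOn.rightInvOn_invFunOn hα

/-! ### `Φ` maps geodesics to straight lines -/

/-- Arclength of the Euclidean chord as a function of the parameter `T` of the geodesic. -/
def chordParam (κ R α T : ℝ) : ℝ :=
  T * (1 + κ * R ^ 2) * fibreNorm κ R α /
    (R * ((1 - κ * R ^ 2) + 4 * κ * R * Real.cos α * T - κ * (1 - κ * R ^ 2) * T ^ 2))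

/-- This expression is `geoDen` times `1 - κ|z|²` at the point `z` of the geodesic, and `|z| ≤ R`
there. The base point `β = 0` is arbitrary. -/
lemma chordParam_den_pos {α T : ℝ} (hα : α ∈ fibre) (hT : T ∈ Icc 0 (endParam κ R α)) :
    0 < (1 - κ * R ^ 2) + 4 * κ * R * Real.cos α * T - κ * (1 - κ * R ^ 2) * T ^ 2 := by
  have hn : ‖geo κ R ((0 : AddCircle (2 * π)), α) T‖ ≤ R := by
    obtain ⟨τ, S, hτ, h0, hend, hmono, hS, hchord⟩ :=
      exists_isChord_geo hR hκ (p := ((0 : AddCircle (2 * π)), α)) hα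
    have hcont : ContinuousOn S (Icc 0 τ) := fun t ht => (hS t ht).continuousWithinAt
    have := intermediate_value_Icc hτ.le hcont
    rw [h0, hend] at this
    obtain ⟨t, ht, rfl⟩ := this hT
    exact hchord.norm_le hR ht
  have h1 := one_sub_pos hκ (norm_nonneg _) hn
  have h2 := geoDen_pos hR hκ hα hT
  rw [one_sub_kappa_norm_geo_sq hR hκ (p := ((0 : AddCircle (2 * π)), α)) hα hT] at h1
  exact (div_pos_iff_of_pos_right h2).1 h1

lemma weight_geo {p : AddCircle (2 * π) × ℝ} (hp : p.2 ∈ fibre) {T : ℝ}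
    (hT : T ∈ Icc 0 (endParam κ R p.2)) : weight κ (geo κ R p T) =
      (1 + κ * R ^ 2) * (1 + κ * T ^ 2) / ((1 - κ * R ^ 2) + 4 * κ * R * Real.cos p.2 * T
        - κ * (1 - κ * R ^ 2) * T ^ 2) := by
  rw [weight, one_add_kappa_norm_geo_sq hR hκ hp hT, one_sub_kappa_norm_geo_sq hR hκ hp hT,
    div_div_div_cancel_right₀ (geoDen_pos hR hκ hp hT).ne']

/-- The geometric meaning of `s`: it is the argument of `e^{iα} + κR² e^{-iα}`, whose modulus is
`fibreNorm`. This vector appears as the direction of the image chord in `Phi_geo`. -/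
lemma cis_sMap {α : ℝ} (hα : α ∈ fibre) : cis (sMap κ R α : ℝ) * fibreNorm κ R α =
    cis (α : ℝ) + κ * R ^ 2 * conj (cis (α : ℝ)) := by
  have hm := (fibreNorm_pos hR hκ α).ne'
  rw [cis_coe_eq, cis_coe_eq, cos_sMap hR hκ hα, sin_sMap hR hκ hα]
  apply Complex.ext
  · simp [← Complex.ofReal_pow, ← Complex.ofReal_mul]; field_simp
  · simp [← Complex.ofReal_pow, ← Complex.ofReal_mul]; field_simp; ring

omit hR hκ in
-- The algebra behind `Phi_geo`: `D D'` cancels, and the remaining identity is polynomial modulo the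
-- relations for `cos α`, `|e^{iα}| = 1` and `s(α)`.
lemma Phi_identity {a a' b e m r k T C N D D' : ℂ} (hC : 2 * C = a + a') (ha : a * a' = 1)
    (he : e * m = a + k * r ^ 2 * a')
    (hN : N = (1 - k * r ^ 2) + 4 * k * r * C * T - k * (1 - k * r ^ 2) * T ^ 2) (hN0 : N ≠ 0)
    (hr : r ≠ 0) (hD' : D' = 1 + k * r * a' * T) (hD0 : D ≠ 0) :
    (1 - k * r ^ 2) / (N / (D * D')) * (b * ((r - a * T) / D) / r) =
      b * (1 - e * (T * (1 + k * r ^ 2) * m / (r * N))) := by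
  field_simp
  linear_combination b * ((1 - k * r ^ 2) * (r - a * T) * hD' - r * hN + T * (1 + k * r ^ 2) * he
    - (1 - k * r ^ 2) * k * r * T ^ 2 * ha - 2 * k * r ^ 2 * T * hC)

lemma Phi_geo {p : AddCircle (2 * π) × ℝ} (hp : p.2 ∈ fibre) {T : ℝ}
    (hT : T ∈ Icc 0 (endParam κ R p.2)) :
    Phi κ R (geo κ R p T) = line (p.1, sMap κ R p.2) (chordParam κ R p.2 T) := by
  have hN := chordParam_den_pos hR hκ hp hT
  have hden := geoDen_pos hR hκ hp hT
  have hD := geo_den_ne_zero hR hκ hp hT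
  have hD' := (map_ne_zero (starRingEnd ℂ)).2 hD
  have hcos : (2 * Real.cos p.2 : ℂ) = cis p.2 + conj (cis p.2) := by
    rw [cis_coe_eq]; apply Complex.ext <;> simp [two_mul, Complex.cos_ofReal_re]
  have ha := conj_cis_mul (p.2 : AddCircle (2 * π))
  have hs := cis_sMap hR hκ hp
  have hNc : ((1 - κ * R ^ 2) + 4 * κ * R * Real.cos p.2 * T - κ * (1 - κ * R ^ 2) * T ^ 2 : ℂ) ≠ 0 := by
    exact_mod_cast hN.ne'
  have hRc : (R : ℂ) ≠ 0 := by exact_mod_cast hR.ne'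
  rw [Phi, one_sub_kappa_norm_geo_sq hR hκ hp hT, line, geo, chordParam]
  push_cast
  rw [ofReal_geoDen]
  have hDc : conj (1 + κ * R * cis p.2 * T : ℂ) = 1 + κ * R * conj (cis p.2) * T := by simp
  rw [hDc] at hD' ⊢
  rw [Complex.ofReal_cos] at hcos hNc
  exact Phi_identity hcos ha hs rfl hNc hRc rfl hD

/-- The numerator is again a multiple of `1 + κT²`. Multiplying by `T' = 1 + κT²` produces the
square that matches `w²` along the geodesic. -/
lemma hasDerivAt_chordParam {α T : ℝ} (hα : α ∈ fibre) (hT : T ∈ Icc 0 (endParam κ R α)) :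
    HasDerivAt (chordParam κ R α) ((1 + κ * R ^ 2) * (1 - κ * R ^ 2) * fibreNorm κ R α *
      (1 + κ * T ^ 2) / (R * ((1 - κ * R ^ 2) + 4 * κ * R * Real.cos α * T
        - κ * (1 - κ * R ^ 2) * T ^ 2) ^ 2)) T := by
  have hN := chordParam_den_pos hR hκ hα hT
  have h1 : HasDerivAt (fun T => T * (1 + κ * R ^ 2) * fibreNorm κ R α)
      ((1 + κ * R ^ 2) * fibreNorm κ R α) T := by
    simpa using ((hasDerivAt_id T).mul_const (1 + κ * R ^ 2)).mul_const (fibreNorm κ R α)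
  have h2 : HasDerivAt (fun T => R * ((1 - κ * R ^ 2) + 4 * κ * R * Real.cos α * T
        - κ * (1 - κ * R ^ 2) * T ^ 2)) (R * (4 * κ * R * Real.cos α
        - κ * (1 - κ * R ^ 2) * (2 * T))) T := by
    have := ((((hasDerivAt_id T).const_mul (4 * κ * R * Real.cos α)).const_add
      (1 - κ * R ^ 2)).fun_sub
      ((hasDerivAt_pow 2 T).const_mul (κ * (1 - κ * R ^ 2)))).const_mul R
    simpa using this
  refine (h1.div h2 (by positivity)).congr_deriv ?_
  field_simp
  ring

lemma chordParam_end {α : ℝ} (hα : α ∈ fibre) :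
    chordParam κ R α (endParam κ R α) = 2 * Real.cos (sMap κ R α) := by
  have h1 := one_sub_kR_pos hR hκ
  have hm := fibreNorm_pos hR hκ α
  have hN : (1 - κ * R ^ 2) + 4 * κ * R * Real.cos α * endParam κ R α
      - κ * (1 - κ * R ^ 2) * endParam κ R α ^ 2 = fibreNorm κ R α ^ 2 / (1 - κ * R ^ 2) := by
    rw [fibreNorm_sq hR hκ, endParam, Real.sin_sq]; field_simp; ring
  have h1' : 1 - R ^ 2 * κ ≠ 0 := by rw [mul_comm]; exact h1.ne'
  rw [chordParam, hN, cos_sMap hR hκ hα, endParam]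
  field_simp

/-- Along each geodesic, `Φ` followed by the Euclidean arclength is an increasing time change whose
speed is a multiple of `w²`. -/
lemma exists_chord_reparam {p : AddCircle (2 * π) × ℝ} (hp : p.2 ∈ fibre) :
    ∃ (c : ℝ × (ℝ → ℂ)) (σ : ℝ → ℝ), IsChord κ R p c ∧
      σ '' Icc 0 c.1 = Icc 0 (2 * Real.cos (sMap κ R p.2)) ∧ InjOn σ (Icc 0 c.1) ∧
      (∀ t ∈ Icc 0 c.1, HasDerivWithinAt σ (dualConst κ R * (Real.sqrt (deriv (sMap κ R) p.2))⁻¹ *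
        weight κ (c.2 t) ^ 2) (Icc 0 c.1) t) ∧
      ∀ t ∈ Icc 0 c.1, Phi κ R (c.2 t) = line (p.1, sMap κ R p.2) (σ t) := by
  obtain ⟨τ, T, hτ, h0, hend, hmono, hT, hchord⟩ := exists_isChord_geo hR hκ hp
  have hmem : ∀ t ∈ Icc 0 τ, T t ∈ Icc 0 (endParam κ R p.2) := fun t ht =>
    ⟨h0 ▸ hmono.monotone ht.1, hend ▸ hmono.monotone ht.2⟩
  have hk1 := one_sub_kR_pos hR hκ
  have hk2 := one_add_kR_pos hR hκ
  have hm := fibreNorm_pos hR hκ p.2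
  have hσ : ∀ t ∈ Icc 0 τ, HasDerivWithinAt (fun t => chordParam κ R p.2 (T t))
      (dualConst κ R * (Real.sqrt (deriv (sMap κ R) p.2))⁻¹ *
        weight κ (geo κ R p (T t)) ^ 2) (Icc 0 τ) t := by
    intro t ht
    have hN := chordParam_den_pos hR hκ hp (hmem t ht)
    refine ((hasDerivAt_chordParam hR hκ hp (hmem t ht)).comp_hasDerivWithinAt t
      (hT t ht)).congr_deriv ?_
    rw [dualConst_mul_inv_sqrt hR hκ hp, weight_geo hR hκ hp (hmem t ht)]
    field_simp
  have hcont : ContinuousOn (fun t => chordParam κ R p.2 (T t)) (Icc 0 τ) :=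
    fun t ht => (hσ t ht).continuousWithinAt
  have hsm : StrictMonoOn (fun t => chordParam κ R p.2 (T t)) (Icc 0 τ) := by
    refine strictMonoOn_of_hasDerivWithinAt_pos (convex_Icc _ _) hcont
      (fun t ht => (hσ t (interior_subset ht)).mono interior_subset) (fun t ht => ?_)
    have ht' := hmem t (interior_subset ht)
    have hN := chordParam_den_pos hR hκ hp ht'
    have := one_add_kappa_sq_pos hR hκ hp ht'
    rw [dualConst_mul_inv_sqrt hR hκ hp, weight_geo hR hκ hp ht']
    positivity
  refine ⟨_, fun t => chordParam κ R p.2 (T t), hchord, ?_, hsm.injOn, hσ,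
    fun t ht => Phi_geo hR hκ hp (hmem t ht)⟩
  have e0 : chordParam κ R p.2 (T 0) = 0 := by simp [h0, chordParam]
  have e1 : chordParam κ R p.2 (T τ) = 2 * Real.cos (sMap κ R p.2) := by
    rw [hend, chordParam_end hR hκ hp]
  apply Subset.antisymm
  · rintro _ ⟨t, ht, rfl⟩
    constructor
    · rw [← e0]; exact hsm.monotoneOn (left_mem_Icc.2 hτ.le) ht ht.1
    · rw [← e1]; exact hsm.monotoneOn ht (right_mem_Icc.2 hτ.le) ht.2
  · have := intermediate_value_Icc hτ.le hcont
    simpa only [e0, e1] using this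

lemma xray_sMap (f : ℂ → ℂ) {p : AddCircle (2 * π) × ℝ} (hp : p.2 ∈ fibre) :
    xray 0 1 f (p.1, sMap κ R p.2) = (dualConst κ R : ℂ) *
      ((Real.sqrt (deriv (sMap κ R) p.2) : ℂ)⁻¹ *
        xray κ R (fun z => (weight κ z : ℂ) ^ 2 * f (Phi κ R z)) p) := by
  obtain ⟨c, σ, hc, himg, hinj, hσ, hΦ⟩ := exists_chord_reparam hR hκ hp
  have hs := sMap_mem_fibre κ R p.2
  have hA : 0 < dualConst κ R * (Real.sqrt (deriv (sMap κ R) p.2))⁻¹ := by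
    rw [dualConst_mul_inv_sqrt hR hκ hp]
    have h1 := one_sub_kR_pos hR hκ
    have h2 := one_add_kR_pos hR hκ
    have hm := fibreNorm_pos hR hκ p.2
    positivity
  rw [xray_eq_of_isChord one_pos (by simp) (isChord_line (p := (p.1, sMap κ R p.2)) hs),
    xray_eq_of_isChord hR hκ hc]
  have hpos : 0 ≤ 2 * Real.cos (sMap κ R p.2) := by
    have := cos_pos_of_mem_fibre hs; positivity
  dsimp only
  rw [intervalIntegral.integral_of_le hpos, intervalIntegral.integral_of_le hc.1.le,
    ← integral_Icc_eq_integral_Ioc, ← integral_Icc_eq_integral_Ioc, ← himg,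
    integral_image_eq_integral_abs_deriv_smul measurableSet_Icc hσ hinj, ← mul_assoc,
    ← integral_const_mul]
  refine setIntegral_congr_fun measurableSet_Icc fun t ht => ?_
  simp only [hΦ t ht]
  rw [abs_of_nonneg (by positivity), Complex.real_smul]
  push_cast
  ring

/-- The change of variables of `xray_sMap` for integrability, which the integral identity alone does
not give because a non-integrable function has integral `0`. -/
lemma intervalIntegrable_chord_sMap (f : ℂ → ℂ) {p : AddCircle (2 * π) × ℝ} (hp : p.2 ∈ fibre) :
    IntervalIntegrable (fun t => f ((chord 0 1 (p.1, sMap κ R p.2)).2 t)) volume 0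
      (chord 0 1 (p.1, sMap κ R p.2)).1 ↔
    IntervalIntegrable (fun t => (weight κ ((chord κ R p).2 t) : ℂ) ^ 2 *
      f (Phi κ R ((chord κ R p).2 t))) volume 0 (chord κ R p).1 := by
  obtain ⟨c, σ, hc, himg, hinj, hσ, hΦ⟩ := exists_chord_reparam hR hκ hp
  have hs := sMap_mem_fibre κ R p.2
  have hA : 0 < dualConst κ R * (Real.sqrt (deriv (sMap κ R) p.2))⁻¹ := by
    rw [dualConst_mul_inv_sqrt hR hκ hp]
    have h1 := one_sub_kR_pos hR hκ
    have h2 := one_add_kR_pos hR hκ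
    have hm := fibreNorm_pos hR hκ p.2
    positivity
  have hpos : 0 ≤ 2 * Real.cos (sMap κ R p.2) := by
    have := cos_pos_of_mem_fibre hs; positivity
  rw [intervalIntegrable_chord_iff one_pos (by simp) (isChord_line (p := (p.1, sMap κ R p.2)) hs),
    intervalIntegrable_chord_iff hR hκ hc (fun z => (weight κ z : ℂ) ^ 2 * f (Phi κ R z)),
    intervalIntegrable_iff_integrableOn_Icc_of_le hpos,
    intervalIntegrable_iff_integrableOn_Icc_of_le hc.1.le, ← himg,
    integrableOn_image_iff_integrableOn_abs_deriv_smul measurableSet_Icc hσ hinj]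
  have hAc : ((dualConst κ R * (Real.sqrt (deriv (sMap κ R) p.2))⁻¹ : ℝ) : ℂ) ≠ 0 := by
    exact_mod_cast hA.ne'
  refine Iff.trans ?_ (integrable_const_mul_iff hAc.isUnit _)
  refine integrableOn_congr_fun (fun t ht => ?_) measurableSet_Icc
  simp only [hΦ t ht]
  rw [abs_of_nonneg (by positivity), Complex.real_smul]
  push_cast
  ring

end

/-! ### Bounded operators between `L²` spaces given by formulas on functions -/

lemma eLpNorm_two_sq {X : Type*} [MeasurableSpace X] (μ : Measure X) (f : X → ℂ) :
    eLpNorm f 2 μ ^ 2 = ∫⁻ x, ‖f x‖ₑ ^ 2 ∂μ := by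
  have := eLpNorm_nnreal_pow_eq_lintegral (μ := μ) (f := f) (p := 2) two_ne_zero
  simpa using this

lemma eLpNorm_two_le_of_lintegral_le {X Y : Type*} [MeasurableSpace X] [MeasurableSpace Y]
    {μ : Measure X} {ν : Measure Y} {f : X → ℂ} {g : Y → ℂ} {C : ℝ≥0∞}
    (h : ∫⁻ x, ‖f x‖ₑ ^ 2 ∂μ ≤ C ^ 2 * ∫⁻ y, ‖g y‖ₑ ^ 2 ∂ν) :
    eLpNorm f 2 μ ≤ C * eLpNorm g 2 ν := by
  rw [← eLpNorm_two_sq, ← eLpNorm_two_sq, ← mul_pow] at h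
  exact (ENNReal.pow_le_pow_left_iff two_ne_zero).1 h

/-- Passes from a formula on representatives, linear almost everywhere and bounded, to an operator
on `L²` classes. -/
lemma exists_Lp_clm {X Y : Type*} [MeasurableSpace X] [MeasurableSpace Y]
    {μ : Measure X} {ν : Measure Y} (L : (Y → ℂ) → X → ℂ) (C : NNReal)
    (hm : ∀ f : Lp ℂ 2 ν, AEStronglyMeasurable (L f) μ)
    (hadd : ∀ f g : Lp ℂ 2 ν, L (f + g : Lp ℂ 2 ν) =ᵐ[μ] L f + L g)
    (hsmul : ∀ (c : ℂ) (f : Lp ℂ 2 ν), L (c • f : Lp ℂ 2 ν) =ᵐ[μ] c • L f)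
    (hb : ∀ f : Lp ℂ 2 ν, eLpNorm (L f) 2 μ ≤ C * eLpNorm f 2 ν) :
    ∃ A : Lp ℂ 2 ν →L[ℂ] Lp ℂ 2 μ, ∀ f, A f =ᵐ[μ] L f := by
  have hmem : ∀ f : Lp ℂ 2 ν, MemLp (L f) 2 μ := fun f =>
    ⟨hm f, (hb f).trans_lt (ENNReal.mul_lt_top ENNReal.coe_lt_top (Lp.eLpNorm_lt_top f))⟩
  let A₀ : Lp ℂ 2 ν →ₗ[ℂ] Lp ℂ 2 μ :=
    { toFun := fun f => (hmem f).toLp _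
      map_add' := fun f g => by
        rw [← MemLp.toLp_add]
        exact MemLp.toLp_congr _ _ (hadd f g)
      map_smul' := fun c f => by
        rw [RingHom.id_apply, ← MemLp.toLp_const_smul]
        exact MemLp.toLp_congr _ _ (hsmul c f) }
  refine ⟨A₀.mkContinuous C fun f => ?_, fun f => (hmem f).coeFn_toLp⟩
  change ‖(hmem f).toLp _‖ ≤ _
  rw [Lp.norm_toLp, Lp.norm_def]
  have := ENNReal.toReal_mono (ENNReal.mul_ne_top ENNReal.coe_ne_top (Lp.eLpNorm_ne_top f)) (hb f)
  rwa [ENNReal.toReal_mul, ENNReal.coe_toReal] at this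

/-! ### The Euclidean X-ray transform is bounded -/

lemma area_zero_one : area 0 1 = volume.restrict (closedBall (0 : ℂ) 1) := by
  simp [area, metric]

lemma boundaryMeasure_zero_one :
    boundaryMeasure 0 1 = (volume : Measure (AddCircle (2 * π))).prod (volume.restrict fibre) := by
  simp [boundaryMeasure]

lemma measurableSet_fibre : MeasurableSet fibre := measurableSet_Ioo

lemma ae_mem_fibre_zero_one : ∀ᵐ p ∂(boundaryMeasure 0 1), p.2 ∈ fibre := by
  rw [boundaryMeasure_zero_one]
  exact Measure.quasiMeasurePreserving_snd.ae (ae_restrict_mem measurableSet_fibre)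

lemma continuous_line :
    Continuous fun q : (AddCircle (2 * π) × ℝ) × ℝ => line q.1 q.2 := by
  have h1 : Continuous fun q : (AddCircle (2 * π) × ℝ) × ℝ => cis q.1.1 :=
    continuous_cis.comp (continuous_fst.comp continuous_fst)
  have h2 : Continuous fun q : (AddCircle (2 * π) × ℝ) × ℝ => cis (q.1.2 : AddCircle (2 * π)) :=
    continuous_cis.comp (AddCircle.continuous_mk' _ |>.comp (continuous_snd.comp continuous_fst))
  have h3 : Continuous fun q : (AddCircle (2 * π) × ℝ) × ℝ => (q.2 : ℂ) :=
    Complex.continuous_ofReal.comp continuous_snd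
  exact h1.mul (continuous_const.sub (h2.mul h3))

lemma line_mem_closedBall_iff {p : AddCircle (2 * π) × ℝ} (hp : p.2 ∈ fibre) (S : ℝ) :
    line p S ∈ closedBall (0 : ℂ) 1 ↔ S ∈ Icc 0 (2 * Real.cos p.2) := by
  have hc := cos_pos_of_mem_fibre hp
  have hn : ‖line p S‖ ^ 2 = 1 - S * (2 * Real.cos p.2 - S) := by
    rw [line, norm_mul, norm_cis, one_mul, Complex.sq_norm, cis_coe_eq]
    have := Real.sin_sq_add_cos_sq p.2
    simp [Complex.normSq_apply]
    linear_combination S ^ 2 * this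
  rw [mem_closedBall_zero_iff, ← sq_le_one_iff₀ (norm_nonneg _), hn, sub_le_self_iff, mem_Icc]
  constructor
  · intro h
    constructor
    · by_contra! hS
      nlinarith
    · by_contra! hS
      nlinarith
  · rintro ⟨h1, h2⟩
    exact mul_nonneg h1 (sub_nonneg.2 h2)

/-- Fubini along the lines of a fixed direction. -/
lemma lintegral_parallel_lines {G : ℂ → ℝ≥0∞} (hG : Measurable G)
    (hsupp : ∀ z, 1 < ‖z‖ → G z = 0) :
    ∫⁻ α in fibre, ENNReal.ofReal (Real.cos α) * ∫⁻ S : ℝ, G (⟨Real.cos α - S, -Real.sin α⟩ : ℂ) =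
      ∫⁻ z, G z := by
  set H : ℝ → ℝ≥0∞ := fun y => ∫⁻ x : ℝ, G ⟨x, y⟩ with hH
  have hmk : Measurable fun q : ℝ × ℝ => (⟨q.1, q.2⟩ : ℂ) :=
    Complex.measurableEquivRealProd.symm.measurable
  have hHzero : ∀ y, y ∉ Icc (-1 : ℝ) 1 → H y = 0 := by
    intro y hy
    have : ∀ x : ℝ, G ⟨x, y⟩ = 0 := fun x => hsupp _ (by
      have h1 := Complex.abs_im_le_norm ⟨x, y⟩
      have h2 : 1 < |y| := by
        by_contra! h
        exact hy (abs_le.1 h)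
      exact h2.trans_le h1)
    simp [hH, this]
  have himg : (fun α => -Real.sin α) '' fibre = Ioo (-1) 1 := by
    have h2 : Real.sin '' fibre = Ioo (-1) 1 := Real.sinPartialHomeomorph.image_source_eq_target
    rw [← Function.comp_def Neg.neg, image_comp, h2]
    simp
  have hinj : InjOn (fun α => -Real.sin α) fibre :=
    neg_injective.comp_injOn (Real.injOn_sin.mono Ioo_subset_Icc_self)
  -- The height of the line is `y = -sin α`, so `cos α dα` is the measure `dy`, and the rest is
  -- Tonelli in Cartesian coordinates.
  calc _ = ∫⁻ α in fibre, ENNReal.ofReal |-Real.cos α| * H (-Real.sin α) := by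
        refine setLIntegral_congr_fun measurableSet_fibre fun α hα => ?_
        have := (cos_pos_of_mem_fibre hα).le
        simp only [abs_neg, abs_of_nonneg this]
        congr 1
        exact lintegral_sub_left_eq_self (μ := volume) (fun x => G ⟨x, -Real.sin α⟩) (Real.cos α)
    _ = ∫⁻ y in Ioo (-1) 1, H y := by
        rw [← himg, lintegral_image_eq_lintegral_abs_deriv_mul (f := fun α => -Real.sin α)
          measurableSet_fibre (fun α _ => (Real.hasDerivAt_sin α).fun_neg.hasDerivWithinAt) hinj]
    _ = ∫⁻ y, H y := by
        rw [setLIntegral_congr Ioo_ae_eq_Icc]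
        refine setLIntegral_eq_of_support_subset ?_
        intro y hy
        by_contra h
        exact hy (hHzero y h)
    _ = ∫⁻ z, G z := by
        rw [← Complex.volume_preserving_equiv_real_prod.symm.lintegral_comp hG,
          Measure.volume_eq_prod, lintegral_prod_symm' (fun q => G (Complex.measurableEquivRealProd.symm q)) (hG.comp hmk)]
        rfl

/-- **Santaló's formula** for the Euclidean unit disk. -/
lemma lintegral_line {G : ℂ → ℝ≥0∞} (hG : Measurable G) (hsupp : ∀ z, 1 < ‖z‖ → G z = 0) :
    ∫⁻ p, ENNReal.ofReal (Real.cos p.2) * (∫⁻ S : ℝ, G (line p S)) ∂(boundaryMeasure 0 1) =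
      ENNReal.ofReal (2 * π) * ∫⁻ z, G z := by
  have hrot : ∀ β : AddCircle (2 * π), MeasurePreserving (fun z : ℂ => cis β * z) := fun β =>
    (rotation (AddCircle.toCircle β)).measurePreserving
  have hGl : Measurable fun q : (AddCircle (2 * π) × ℝ) × ℝ => G (line q.1 q.2) :=
    hG.comp continuous_line.measurable
  have hF : Measurable fun p : AddCircle (2 * π) × ℝ =>
      ENNReal.ofReal (Real.cos p.2) * ∫⁻ S : ℝ, G (line p S) :=
    (Real.measurable_cos.comp measurable_snd).ennreal_ofReal.mul hGl.lintegral_prod_right'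
  -- Shifting `β` by `α` fixes the direction of the chord at `-e^{iβ}`: for each `β` the chords
  -- become a rotated family of parallel lines.
  have hshift : ∀ (β : AddCircle (2 * π)) (α S : ℝ),
      line (β - (α : AddCircle (2 * π)), α) S = cis β * (⟨Real.cos α - S, -Real.sin α⟩ : ℂ) := by
    intro β α S
    have h1 : cis (β - (α : AddCircle (2 * π))) * cis (α : AddCircle (2 * π)) = cis β := by
      rw [← cis_add, sub_add_cancel]
    have h2 := conj_cis_mul (α : AddCircle (2 * π))
    have h3 : (⟨Real.cos α - S, -Real.sin α⟩ : ℂ) = conj (cis (α : AddCircle (2 * π))) - S := by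
      rw [cis_coe_eq]; apply Complex.ext <;> simp
    rw [h3, line]
    linear_combination (-cis (β - (α : AddCircle (2 * π)))) * h2 +
      (conj (cis (α : AddCircle (2 * π))) - S) * h1
  rw [boundaryMeasure_zero_one, lintegral_prod_symm' _ hF]
  have h1 : ∀ α : ℝ, ∫⁻ β : AddCircle (2 * π), ENNReal.ofReal (Real.cos α) *
      ∫⁻ S : ℝ, G (line (β, α) S) = ∫⁻ β : AddCircle (2 * π), ENNReal.ofReal (Real.cos α) *
      ∫⁻ S : ℝ, G (cis β * (⟨Real.cos α - S, -Real.sin α⟩ : ℂ)) := by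
    intro α
    rw [← lintegral_sub_right_eq_self _ (α : AddCircle (2 * π))]
    simp only [hshift]
  have hF2 : Measurable fun q : ℝ × AddCircle (2 * π) => ENNReal.ofReal (Real.cos q.1) *
      ∫⁻ S : ℝ, G (cis q.2 * (⟨Real.cos q.1 - S, -Real.sin q.1⟩ : ℂ)) := by
    have hmap : Measurable fun q : ℝ × AddCircle (2 * π) =>
        ((q.2 - (q.1 : AddCircle (2 * π)), q.1) : AddCircle (2 * π) × ℝ) := by
      refine Measurable.prodMk (measurable_snd.sub ?_) measurable_fst
      exact (AddCircle.continuous_mk' _).measurable.comp measurable_fst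
    have := hF.comp hmap
    simpa only [Function.comp_def, hshift] using this
  simp only [h1]
  rw [lintegral_lintegral_swap hF2.aemeasurable]
  have h2 : ∀ β : AddCircle (2 * π), ∫⁻ α in fibre, ENNReal.ofReal (Real.cos α) *
      ∫⁻ S : ℝ, G (cis β * (⟨Real.cos α - S, -Real.sin α⟩ : ℂ)) = ∫⁻ z, G z := by
    intro β
    rw [lintegral_parallel_lines (G := fun z => G (cis β * z)) (hG.comp (hrot β).measurable)
      (fun z hz => hsupp _ (by rwa [norm_mul, norm_cis, one_mul]))]
    exact (hrot β).lintegral_comp hG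
  simp only [h2, lintegral_const, AddCircle.measure_univ]
  rw [mul_comm]

/-- The integral of `f` over the chord of the unit disk with end point and direction `p`. -/
def lineIntegral (f : ℂ → ℂ) (p : AddCircle (2 * π) × ℝ) : ℂ :=
  ∫ S : ℝ, (closedBall (0 : ℂ) 1).indicator f (line p S)

lemma xray_zero_one_eq {p : AddCircle (2 * π) × ℝ} (hp : p.2 ∈ fibre) (f : ℂ → ℂ) :
    xray 0 1 f p = lineIntegral f p := by
  have hpos : 0 ≤ 2 * Real.cos p.2 := by
    have := cos_pos_of_mem_fibre hp; positivity
  rw [xray_eq_of_isChord one_pos (by simp) (isChord_line hp), lineIntegral]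
  dsimp only
  rw [intervalIntegral.integral_of_le hpos, ← integral_Icc_eq_integral_Ioc,
    ← integral_indicator measurableSet_Icc]
  congr 1 with S
  simp only [indicator, line_mem_closedBall_iff hp]

/-- Santaló's formula applied to the indicator of a null set; the weight `cos α` is positive and can
be dropped. This makes line integrals well defined on `L²` classes. -/
lemma ae_line_of_ae {P : ℂ → Prop} (h : ∀ᵐ z ∂(area 0 1), P z) :
    ∀ᵐ p ∂(boundaryMeasure 0 1), ∀ᵐ S : ℝ, line p S ∈ closedBall (0 : ℂ) 1 → P (line p S) := by
  rw [area_zero_one, ae_restrict_iff' measurableSet_closedBall] at h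
  obtain ⟨t, hst, htm, ht0⟩ := exists_measurable_superset_of_null h
  set G : ℂ → ℝ≥0∞ := (closedBall (0 : ℂ) 1 ∩ t).indicator 1
  have hG : Measurable G := measurable_one.indicator (measurableSet_closedBall.inter htm)
  have hGl : Measurable fun q : (AddCircle (2 * π) × ℝ) × ℝ => G (line q.1 q.2) :=
    hG.comp continuous_line.measurable
  have hF : Measurable fun p : AddCircle (2 * π) × ℝ =>
      ENNReal.ofReal (Real.cos p.2) * ∫⁻ S : ℝ, G (line p S) :=
    (Real.measurable_cos.comp measurable_snd).ennreal_ofReal.mul hGl.lintegral_prod_right'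
  have hzero : ∫⁻ z, G z = 0 := by
    rw [lintegral_indicator_one (measurableSet_closedBall.inter htm)]
    exact measure_mono_null inter_subset_right ht0
  have h := lintegral_line hG (fun z hz => indicator_of_notMem (fun h => by
    have := h.1
    rw [mem_closedBall_zero_iff] at this
    linarith) _)
  rw [hzero, mul_zero, lintegral_eq_zero_iff hF] at h
  filter_upwards [h, ae_mem_fibre_zero_one] with p hp hfib
  have hc := cos_pos_of_mem_fibre hfib
  simp only [Pi.zero_apply, mul_eq_zero, ENNReal.ofReal_eq_zero, not_le.2 hc, false_or] at hp
  have hGp : Measurable fun S : ℝ => G (line p S) :=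
    hG.comp (continuous_line.measurable.comp measurable_prodMk_left)
  rw [lintegral_eq_zero_iff hGp] at hp
  filter_upwards [hp] with S hS hball
  by_contra hP
  have hmem : line p S ∈ closedBall (0 : ℂ) 1 ∩ t := ⟨hball, hst fun h => hP (h hball)⟩
  simp [G, indicator_of_mem hmem] at hS

lemma lineIntegral_congr_ae {f g : ℂ → ℂ} (h : f =ᵐ[area 0 1] g) :
    lineIntegral f =ᵐ[boundaryMeasure 0 1] lineIntegral g := by
  filter_upwards [ae_line_of_ae h] with p hp
  refine integral_congr_ae ?_
  filter_upwards [hp] with S hS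
  by_cases hb : line p S ∈ closedBall (0 : ℂ) 1
  · simp [indicator_of_mem hb, hS hb]
  · simp [indicator_of_notMem hb]

lemma lintegral_indicator_ball (f : ℂ → ℂ) {n : ℕ} (hn : n ≠ 0) :
    ∫⁻ z, ‖(closedBall (0 : ℂ) 1).indicator f z‖ₑ ^ n = ∫⁻ z, ‖f z‖ₑ ^ n ∂(area 0 1) := by
  rw [area_zero_one, ← lintegral_indicator measurableSet_closedBall]
  congr 1 with z
  by_cases hb : z ∈ closedBall (0 : ℂ) 1
  · simp only [indicator_of_mem hb]
  · simp [indicator_of_notMem hb, hn]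

/-- On a disk of finite area `L²` functions are integrable, and Santaló's formula for `|f|` gives
finiteness on almost every line. -/
lemma ae_integrable_line {f : ℂ → ℂ} (hf : StronglyMeasurable f) (hf2 : MemLp f 2 (area 0 1)) :
    ∀ᵐ p ∂(boundaryMeasure 0 1),
      Integrable fun S : ℝ => (closedBall (0 : ℂ) 1).indicator f (line p S) := by
  have hfin : IsFiniteMeasure (area 0 1) := by
    rw [area_zero_one]
    exact ⟨by rw [Measure.restrict_apply_univ]; exact measure_closedBall_lt_top⟩
  have hint : Integrable f (area 0 1) := hf2.integrable one_le_two
  have hfi : StronglyMeasurable ((closedBall (0 : ℂ) 1).indicator f) :=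
    hf.indicator measurableSet_closedBall
  set G : ℂ → ℝ≥0∞ := fun z => ‖(closedBall (0 : ℂ) 1).indicator f z‖ₑ ^ 1
  have hG : Measurable G := hfi.measurable.enorm.pow_const 1
  have hGl : Measurable fun q : (AddCircle (2 * π) × ℝ) × ℝ => G (line q.1 q.2) :=
    hG.comp continuous_line.measurable
  have hF : Measurable fun p : AddCircle (2 * π) × ℝ =>
      ENNReal.ofReal (Real.cos p.2) * ∫⁻ S : ℝ, G (line p S) :=
    (Real.measurable_cos.comp measurable_snd).ennreal_ofReal.mul hGl.lintegral_prod_right'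
  have h := lintegral_line hG (fun z hz => by
    simp [G, hz])
  rw [lintegral_indicator_ball f one_ne_zero] at h
  have hlt : ∫⁻ p, ENNReal.ofReal (Real.cos p.2) * (∫⁻ S : ℝ, G (line p S))
      ∂(boundaryMeasure 0 1) ≠ ∞ := by
    rw [h]
    refine ENNReal.mul_ne_top ENNReal.ofReal_ne_top ?_
    simpa using hint.2.ne
  filter_upwards [ae_lt_top hF hlt, ae_mem_fibre_zero_one] with p hp hfib
  have hc := cos_pos_of_mem_fibre hfib
  refine ⟨(hfi.comp_measurable
    (continuous_line.measurable.comp measurable_prodMk_left)).aestronglyMeasurable, ?_⟩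
  have h2 := (ENNReal.mul_lt_top_iff.1 hp)
  rcases h2 with h2 | h2 | h2
  · simpa [G, HasFiniteIntegral] using h2.2
  · simp only [ENNReal.ofReal_eq_zero] at h2; linarith
  · rw [HasFiniteIntegral]
    simp only [G, pow_one] at h2
    rw [h2]; exact ENNReal.zero_lt_top

/-- Cauchy–Schwarz on a chord of length `2 cos α`. The factor `cos α` is exactly the weight in
Santaló's formula, whence the operator bound `√(2 · 2π)`. -/
lemma enorm_lineIntegral_sq_le {f : ℂ → ℂ} (hf : StronglyMeasurable f)
    {p : AddCircle (2 * π) × ℝ} (hp : p.2 ∈ fibre) :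
    ‖lineIntegral f p‖ₑ ^ 2 ≤ 2 * (ENNReal.ofReal (Real.cos p.2) *
      ∫⁻ S : ℝ, ‖(closedBall (0 : ℂ) 1).indicator f (line p S)‖ₑ ^ 2) := by
  set h : ℝ → ℝ≥0∞ := fun S => ‖(closedBall (0 : ℂ) 1).indicator f (line p S)‖ₑ
  have hfi : StronglyMeasurable ((closedBall (0 : ℂ) 1).indicator f) :=
    hf.indicator measurableSet_closedBall
  have hm : Measurable h := (hfi.comp_measurable
    (continuous_line.measurable.comp measurable_prodMk_left)).measurable.enorm
  set s := Icc 0 (2 * Real.cos p.2)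
  have hs : ∫⁻ S, h S = ∫⁻ S in s, h S * 1 := by
    simp only [mul_one]
    refine (setLIntegral_eq_of_support_subset fun S hS => ?_).symm
    by_contra hn
    rw [← line_mem_closedBall_iff hp] at hn
    exact hS (by simp only [h, indicator_of_notMem hn, enorm_zero])
  have hc := cos_pos_of_mem_fibre hp
  have h1 := ENNReal.lintegral_mul_le_Lp_mul_Lq (volume.restrict s) Real.HolderConjugate.two_two
    hm.aemeasurable (aemeasurable_const (b := (1 : ℝ≥0∞)))
  have h2 : ‖lineIntegral f p‖ₑ ≤ ∫⁻ S, h S := enorm_integral_le_lintegral_enorm _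
  calc ‖lineIntegral f p‖ₑ ^ 2 ≤ (∫⁻ S in s, h S * 1) ^ 2 := by rw [← hs]; gcongr
    _ ≤ ((∫⁻ S in s, h S ^ (2 : ℝ)) ^ (1 / 2 : ℝ) *
          (∫⁻ S in s, (1 : ℝ≥0∞) ^ (2 : ℝ)) ^ (1 / 2 : ℝ)) ^ 2 := by gcongr; exact h1
    _ = (∫⁻ S in s, h S ^ 2) * volume s := by
        rw [mul_pow, ← ENNReal.rpow_natCast, ← ENNReal.rpow_natCast, ← ENNReal.rpow_mul,
          ← ENNReal.rpow_mul]
        simp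
    _ ≤ (∫⁻ S, h S ^ 2) * volume s := by gcongr; exact Measure.restrict_le_self
    _ = _ := by
        rw [Real.volume_Icc, sub_zero, ENNReal.ofReal_mul zero_le_two]
        simp only [ENNReal.ofReal_ofNat]
        ring

lemma eLpNorm_lineIntegral_le {f : ℂ → ℂ} (hf : StronglyMeasurable f) :
    eLpNorm (lineIntegral f) 2 (boundaryMeasure 0 1) ≤
      (Real.sqrt (4 * π)).toNNReal * eLpNorm f 2 (area 0 1) := by
  apply eLpNorm_two_le_of_lintegral_le
  have hfi : StronglyMeasurable ((closedBall (0 : ℂ) 1).indicator f) :=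
    hf.indicator measurableSet_closedBall
  set G : ℂ → ℝ≥0∞ := fun z => ‖(closedBall (0 : ℂ) 1).indicator f z‖ₑ ^ 2
  have hG : Measurable G := hfi.measurable.enorm.pow_const 2
  have hGl : Measurable fun q : (AddCircle (2 * π) × ℝ) × ℝ => G (line q.1 q.2) :=
    hG.comp continuous_line.measurable
  have hF : Measurable fun p : AddCircle (2 * π) × ℝ =>
      ENNReal.ofReal (Real.cos p.2) * ∫⁻ S : ℝ, G (line p S) :=
    (Real.measurable_cos.comp measurable_snd).ennreal_ofReal.mul hGl.lintegral_prod_right'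
  have h := lintegral_line hG (fun z hz => by
    simp [G, hz])
  rw [lintegral_indicator_ball f two_ne_zero] at h
  calc ∫⁻ p, ‖lineIntegral f p‖ₑ ^ 2 ∂(boundaryMeasure 0 1)
      ≤ ∫⁻ p, 2 * (ENNReal.ofReal (Real.cos p.2) * ∫⁻ S : ℝ, G (line p S))
          ∂(boundaryMeasure 0 1) := by
        refine lintegral_mono_ae ?_
        filter_upwards [ae_mem_fibre_zero_one] with p hp
        exact enorm_lineIntegral_sq_le hf hp
    _ = 2 * (ENNReal.ofReal (2 * π) * ∫⁻ z, ‖f z‖ₑ ^ 2 ∂(area 0 1)) := by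
        rw [lintegral_const_mul _ hF, h]
    _ = _ := by
        rw [← mul_assoc]
        congr 1
        change _ = ENNReal.ofReal (Real.sqrt (4 * π)) ^ 2
        rw [← ENNReal.ofReal_pow (Real.sqrt_nonneg _), Real.sq_sqrt (by positivity),
          ← ENNReal.ofReal_ofNat 2, ← ENNReal.ofReal_mul zero_le_two]
        ring_nf

lemma stronglyMeasurable_lineIntegral {f : ℂ → ℂ} (hf : StronglyMeasurable f) :
    StronglyMeasurable (lineIntegral f) := by
  have hfi : StronglyMeasurable ((closedBall (0 : ℂ) 1).indicator f) :=
    hf.indicator measurableSet_closedBall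
  exact StronglyMeasurable.integral_prod_right'
    (f := fun q : (AddCircle (2 * π) × ℝ) × ℝ => (closedBall (0 : ℂ) 1).indicator f (line q.1 q.2))
    (hfi.comp_measurable continuous_line.measurable)

lemma exists_isXrayOperator_zero_one :
    ∃ A : Lp ℂ 2 (area 0 1) →L[ℂ] Lp ℂ 2 (boundaryMeasure 0 1), IsXrayOperator 0 1 A := by
  obtain ⟨A, hA⟩ := exists_Lp_clm (μ := boundaryMeasure 0 1) (ν := area 0 1) lineIntegral
    (Real.sqrt (4 * π)).toNNReal
    (fun f => (stronglyMeasurable_lineIntegral (Lp.stronglyMeasurable f)).aestronglyMeasurable)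
    (fun f g => by
      refine (lineIntegral_congr_ae (Lp.coeFn_add f g)).trans ?_
      filter_upwards [ae_integrable_line (Lp.stronglyMeasurable f) (Lp.memLp f),
        ae_integrable_line (Lp.stronglyMeasurable g) (Lp.memLp g)] with p h1 h2
      simp only [lineIntegral, indicator_add', Pi.add_apply]
      exact integral_add h1 h2)
    (fun c f => by
      refine (lineIntegral_congr_ae (Lp.coeFn_smul c f)).trans (Filter.Eventually.of_forall ?_)
      intro p
      simp only [lineIntegral, Pi.smul_apply, smul_eq_mul, ← integral_const_mul]
      congr 1 with S
      by_cases hb : line p S ∈ closedBall (0 : ℂ) 1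
      · simp only [indicator_of_mem hb, Pi.smul_apply, smul_eq_mul]
      · simp only [indicator_of_notMem hb, mul_zero])
    (fun f => eLpNorm_lineIntegral_le (Lp.stronglyMeasurable f))
  refine ⟨A, fun f => ?_⟩
  filter_upwards [hA f, ae_integrable_line (Lp.stronglyMeasurable f) (Lp.memLp f),
    ae_mem_fibre_zero_one] with p h1 h2 hp
  have hpos : 0 ≤ 2 * Real.cos p.2 := by
    have := cos_pos_of_mem_fibre hp; positivity
  rw [intervalIntegrable_chord_iff one_pos (by simp) (isChord_line hp), h1, xray_zero_one_eq hp]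
  refine ⟨?_, rfl⟩
  rw [intervalIntegrable_iff_integrableOn_Icc_of_le hpos]
  refine h2.integrableOn.congr_fun (fun S hS => ?_) measurableSet_Icc
  exact indicator_of_mem ((line_mem_closedBall_iff hp S).2 hS) _

/-! ### Weighted composition operators -/

/-- `φ` pushes the measure `J μ` forward to `c ν`, with left inverse `ψ` and `J` bounded from above
and from below. -/
structure IsWeightedEquiv {X Y : Type*} [MeasurableSpace X] [MeasurableSpace Y]
    (μ : Measure X) (ν : Measure Y) (φ : X → Y) (ψ : Y → X) (J : X → ℝ) (c : ℝ) : Prop where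
  measurable_toFun : Measurable φ
  measurable_invFun : Measurable ψ
  measurable_weight : Measurable J
  exists_lower : ∃ m > 0, ∀ᵐ x ∂μ, m ≤ J x
  exists_upper : ∃ M, ∀ᵐ x ∂μ, J x ≤ M
  const_pos : 0 < c
  map_eq : (μ.withDensity fun x => ENNReal.ofReal (J x)).map φ = ENNReal.ofReal c • ν
  left_inv : ∀ᵐ x ∂μ, ψ (φ x) = x

lemma quasiMeasurePreserving_of_lintegral_le {X Y : Type*} [MeasurableSpace X] [MeasurableSpace Y]
    {μ : Measure X} {ν : Measure Y} {φ : X → Y} {K : NNReal} (hφ : Measurable φ)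
    (hK : ∀ g : Y → ℝ≥0∞, Measurable g → ∫⁻ x, g (φ x) ∂μ ≤ K * ∫⁻ y, g y ∂ν) :
    Measure.QuasiMeasurePreserving φ μ ν := by
  refine ⟨hφ, Measure.AbsolutelyContinuous.mk fun s hs h0 => ?_⟩
  have := hK (s.indicator 1) (measurable_one.indicator hs)
  rw [lintegral_indicator_one hs, h0, mul_zero, ← lintegral_map (measurable_one.indicator hs) hφ,
    lintegral_indicator_one hs] at this
  exact nonpos_iff_eq_zero.1 this

lemma exists_weightedComp {X Y : Type*} [MeasurableSpace X] [MeasurableSpace Y]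
    {μ : Measure X} {ν : Measure Y} {φ : X → Y} {a : X → ℝ} {B K : NNReal}
    (hφ : Measurable φ) (ha : Measurable a) (hB : ∀ᵐ x ∂μ, |a x| ≤ B)
    (hK : ∀ g : Y → ℝ≥0∞, Measurable g → ∫⁻ x, g (φ x) ∂μ ≤ K * ∫⁻ y, g y ∂ν) :
    ∃ A : Lp ℂ 2 ν →L[ℂ] Lp ℂ 2 μ, ∀ h, A h =ᵐ[μ] fun x => (a x : ℂ) * h (φ x) := by
  have hq := quasiMeasurePreserving_of_lintegral_le hφ hK
  refine exists_Lp_clm (fun h x => (a x : ℂ) * h (φ x)) (B * NNReal.sqrt K) (fun f => ?_)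
    (fun f g => ?_) (fun c f => ?_) (fun f => eLpNorm_two_le_of_lintegral_le ?_)
  · exact (Complex.measurable_ofReal.comp ha).aestronglyMeasurable.mul
      ((Lp.stronglyMeasurable f).comp_measurable hφ).aestronglyMeasurable
  · filter_upwards [hq.ae (Lp.coeFn_add f g)] with x hx
    simp only [hx, Pi.add_apply, mul_add]
  · filter_upwards [hq.ae (Lp.coeFn_smul c f)] with x hx
    simp only [hx, Pi.smul_apply, smul_eq_mul]
    ring
  · have hm : Measurable fun y => ‖f y‖ₑ ^ 2 :=
      (Lp.stronglyMeasurable f).measurable.enorm.pow_const 2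
    calc ∫⁻ x, ‖(a x : ℂ) * f (φ x)‖ₑ ^ 2 ∂μ
        ≤ ∫⁻ x, (B : ℝ≥0∞) ^ 2 * ‖f (φ x)‖ₑ ^ 2 ∂μ := by
          refine lintegral_mono_ae ?_
          filter_upwards [hB] with x hx
          rw [enorm_mul, mul_pow]
          gcongr
          rw [enorm_le_coe, ← NNReal.coe_le_coe]
          simpa using hx
      _ = (B : ℝ≥0∞) ^ 2 * ∫⁻ x, ‖f (φ x)‖ₑ ^ 2 ∂μ := lintegral_const_mul _ (hm.comp hφ)
      _ ≤ (B : ℝ≥0∞) ^ 2 * (K * ∫⁻ y, ‖f y‖ₑ ^ 2 ∂ν) := by gcongr; exact hK _ hm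
      _ = _ := by
          rw [ENNReal.coe_mul, mul_pow, ← mul_assoc]
          congr 2
          rw [← ENNReal.coe_pow, NNReal.sq_sqrt]

namespace IsWeightedEquiv

variable {X Y : Type*} [MeasurableSpace X] [MeasurableSpace Y]
  {μ : Measure X} {ν : Measure Y} {φ : X → Y} {ψ : Y → X} {J : X → ℝ} {c : ℝ}

lemma lintegral_eq (h : IsWeightedEquiv μ ν φ ψ J c) {g : Y → ℝ≥0∞} (hg : Measurable g) :
    ∫⁻ x, ENNReal.ofReal (J x) * g (φ x) ∂μ = ENNReal.ofReal c * ∫⁻ y, g y ∂ν := by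
  have h1 := congrArg (fun m => ∫⁻ y, g y ∂m) h.map_eq
  rwa [lintegral_map hg h.measurable_toFun, lintegral_smul_measure,
    lintegral_withDensity_eq_lintegral_mul _ h.measurable_weight.ennreal_ofReal
      (g := fun x => g (φ x)) (hg.comp h.measurable_toFun)] at h1

/-- The lower bound on `J` controls composition with `φ`; in the next lemma the upper bound controls
composition with `ψ`. Both give bounded operators and transport of null sets. -/
lemma exists_lintegral_comp_le (h : IsWeightedEquiv μ ν φ ψ J c) : ∃ K : NNReal,
    ∀ g : Y → ℝ≥0∞, Measurable g → ∫⁻ x, g (φ x) ∂μ ≤ K * ∫⁻ y, g y ∂ν := by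
  obtain ⟨m, hm, hJ⟩ := h.exists_lower
  refine ⟨m⁻¹.toNNReal * c.toNNReal, fun g hg => ?_⟩
  calc ∫⁻ x, g (φ x) ∂μ
      ≤ ∫⁻ x, ENNReal.ofReal m⁻¹ * (ENNReal.ofReal (J x) * g (φ x)) ∂μ := by
        refine lintegral_mono_ae ?_
        filter_upwards [hJ] with x hx
        rw [← mul_assoc, ← ENNReal.ofReal_mul (by positivity)]
        refine le_mul_of_one_le_left zero_le ?_
        rw [ENNReal.one_le_ofReal, inv_mul_eq_div, one_le_div hm]
        exact hx
    _ = _ := by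
        have hm : Measurable fun x => ENNReal.ofReal (J x) * g (φ x) :=
          h.measurable_weight.ennreal_ofReal.mul (hg.comp h.measurable_toFun)
        rw [lintegral_const_mul _ hm, h.lintegral_eq hg, ← mul_assoc]
        rfl

lemma exists_lintegral_comp_symm_le (h : IsWeightedEquiv μ ν φ ψ J c) : ∃ K : NNReal,
    ∀ g : X → ℝ≥0∞, Measurable g → ∫⁻ y, g (ψ y) ∂ν ≤ K * ∫⁻ x, g x ∂μ := by
  obtain ⟨M, hM⟩ := h.exists_upper
  refine ⟨c⁻¹.toNNReal * M.toNNReal, fun g hg => ?_⟩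
  have hc : ENNReal.ofReal c⁻¹ * ENNReal.ofReal c = 1 := by
    rw [← ENNReal.ofReal_mul (inv_nonneg.2 h.const_pos.le), inv_mul_cancel₀ h.const_pos.ne',
      ENNReal.ofReal_one]
  calc ∫⁻ y, g (ψ y) ∂ν
      = ENNReal.ofReal c⁻¹ * ∫⁻ x, ENNReal.ofReal (J x) * g (ψ (φ x)) ∂μ := by
        rw [h.lintegral_eq (g := fun y => g (ψ y)) (hg.comp h.measurable_invFun), ← mul_assoc, hc,
          one_mul]
    _ ≤ ENNReal.ofReal c⁻¹ * ∫⁻ x, ENNReal.ofReal M * g x ∂μ := by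
        gcongr ENNReal.ofReal c⁻¹ * ?_
        refine lintegral_mono_ae ?_
        filter_upwards [hM, h.left_inv] with x h1 h2
        rw [h2]
        gcongr
    _ = _ := by
        rw [lintegral_const_mul _ hg, ← mul_assoc]
        rfl

lemma quasi (h : IsWeightedEquiv μ ν φ ψ J c) : Measure.QuasiMeasurePreserving φ μ ν :=
  quasiMeasurePreserving_of_lintegral_le h.measurable_toFun h.exists_lintegral_comp_le.choose_spec

lemma quasi_symm (h : IsWeightedEquiv μ ν φ ψ J c) : Measure.QuasiMeasurePreserving ψ ν μ :=
  quasiMeasurePreserving_of_lintegral_le h.measurable_invFun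
    h.exists_lintegral_comp_symm_le.choose_spec

lemma exists_comp (h : IsWeightedEquiv μ ν φ ψ J c) {a : X → ℝ} (ha : Measurable a)
    (hB : ∃ B, ∀ᵐ x ∂μ, |a x| ≤ B) :
    ∃ A : Lp ℂ 2 ν →L[ℂ] Lp ℂ 2 μ, ∀ f, A f =ᵐ[μ] fun x => (a x : ℂ) * f (φ x) := by
  obtain ⟨B, hB⟩ := hB
  obtain ⟨K, hK⟩ := h.exists_lintegral_comp_le
  refine exists_weightedComp (B := B.toNNReal) h.measurable_toFun ha ?_ hK
  filter_upwards [hB] with x hx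
  exact hx.trans (Real.le_coe_toNNReal B)

lemma exists_comp_symm (h : IsWeightedEquiv μ ν φ ψ J c) {b : X → ℝ} (hb : Measurable b)
    (hB : ∃ B, ∀ᵐ x ∂μ, |b x| ≤ B) :
    ∃ A : Lp ℂ 2 μ →L[ℂ] Lp ℂ 2 ν, ∀ f, A f =ᵐ[ν] fun y => (b (ψ y) : ℂ) * f (ψ y) := by
  obtain ⟨B, hB⟩ := hB
  obtain ⟨K, hK⟩ := h.exists_lintegral_comp_symm_le
  refine exists_weightedComp (a := fun y => b (ψ y)) (B := B.toNNReal) h.measurable_invFun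
    (hb.comp h.measurable_invFun) ?_ hK
  filter_upwards [h.quasi_symm.ae hB] with x hx
  exact hx.trans (Real.le_coe_toNNReal B)

lemma integral_eq (h : IsWeightedEquiv μ ν φ ψ J c) {F : Y → ℂ} (hF : StronglyMeasurable F) :
    ∫ x, (J x : ℂ) * F (φ x) ∂μ = c * ∫ y, F y ∂ν := by
  obtain ⟨m, hm, hJ⟩ := h.exists_lower
  have h1 := congrArg (fun m => ∫ y, F y ∂m) h.map_eq
  rw [integral_map h.measurable_toFun.aemeasurable hF.aestronglyMeasurable,
    integral_smul_measure, ENNReal.toReal_ofReal h.const_pos.le,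
    integral_withDensity_eq_integral_toReal_smul h.measurable_weight.ennreal_ofReal
      (Filter.Eventually.of_forall fun x => ENNReal.ofReal_lt_top), Complex.real_smul] at h1
  rw [← h1]
  refine integral_congr_ae ?_
  filter_upwards [hJ] with x hx
  rw [ENNReal.toReal_ofReal (hm.le.trans hx), Complex.real_smul]

/-- Writing `a = J b`, the factor `J` converts the integral over `μ` into `c` times one over `ν`:
the adjoint of `a φ^*` is `c ψ^* b`. -/
lemma inner_comp (h : IsWeightedEquiv μ ν φ ψ J c) {a b : X → ℝ} (hb : Measurable b)
    (hab : ∀ᵐ x ∂μ, J x * b x = a x) {A : Lp ℂ 2 ν →L[ℂ] Lp ℂ 2 μ}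
    {S : Lp ℂ 2 μ →L[ℂ] Lp ℂ 2 ν} (hA : ∀ f, A f =ᵐ[μ] fun x => (a x : ℂ) * f (φ x))
    (hS : ∀ f, S f =ᵐ[ν] fun y => (b (ψ y) : ℂ) * f (ψ y)) (f : Lp ℂ 2 ν) (g : Lp ℂ 2 μ) :
    inner ℂ (A f) g = c * inner ℂ f (S g) := by
  have hF : StronglyMeasurable fun y => conj (f y) * ((b (ψ y) : ℂ) * g (ψ y)) := by
    refine (Complex.continuous_conj.comp_stronglyMeasurable (Lp.stronglyMeasurable f)).mul ?_
    exact (Complex.measurable_ofReal.comp (hb.comp h.measurable_invFun)).stronglyMeasurable.mul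
      ((Lp.stronglyMeasurable g).comp_measurable h.measurable_invFun)
  have e1 : inner ℂ f (S g) = ∫ y, conj (f y) * ((b (ψ y) : ℂ) * g (ψ y)) ∂ν := by
    rw [L2.inner_def]
    refine integral_congr_ae ?_
    filter_upwards [hS g] with y hy
    rw [hy, RCLike.inner_apply]
    ring
  have e2 : inner ℂ (A f) g =
      ∫ x, (J x : ℂ) * (conj (f (φ x)) * ((b (ψ (φ x)) : ℂ) * g (ψ (φ x)))) ∂μ := by
    rw [L2.inner_def]
    refine integral_congr_ae ?_
    filter_upwards [hA f, hab, h.left_inv] with x h1 h2 h3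
    rw [h1, h3, ← h2, RCLike.inner_apply]
    simp only [map_mul, Complex.conj_ofReal, Complex.ofReal_mul]
    ring
  rw [e1, e2, h.integral_eq hF]

end IsWeightedEquiv

/-! ### The map `Φ` -/

/-- Explicit formula for `Φ⁻¹` on the closed unit disk. -/
def PhiSymm (κ R : ℝ) (z : ℂ) : ℂ :=
  ((2 * R / ((1 - κ * R ^ 2) +
    Real.sqrt ((1 - κ * R ^ 2) ^ 2 + 4 * (κ * R ^ 2) * ‖z‖ ^ 2)) : ℝ) : ℂ) * z

lemma measurable_weight (κ : ℝ) : Measurable (weight κ) := by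
  unfold weight; fun_prop

lemma measurable_Phi (κ R : ℝ) : Measurable (Phi κ R) := by
  unfold Phi; fun_prop

lemma measurable_PhiSymm (κ R : ℝ) : Measurable (PhiSymm κ R) := by
  unfold PhiSymm; fun_prop

section
variable {κ R : ℝ} (hR : 0 < R) (hκ : R ^ 2 * |κ| < 1)
include hR hκ

omit hR hκ in
lemma disc_nonneg {z : ℂ} (hz : ‖z‖ ≤ 1) :
    0 ≤ (1 - κ * R ^ 2) ^ 2 + 4 * (κ * R ^ 2) * ‖z‖ ^ 2 := by
  have h : ‖z‖ ^ 2 ≤ 1 := pow_le_one₀ (norm_nonneg _) hz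
  rcases le_total 0 (κ * R ^ 2) with h1 | h1
  · positivity
  · nlinarith [sq_nonneg (1 + κ * R ^ 2)]

lemma norm_PhiSymm_le {z : ℂ} (hz : ‖z‖ ≤ 1) : ‖PhiSymm κ R z‖ ≤ R := by
  have hk := one_sub_kR_pos hR hκ
  have hd := disc_nonneg (κ := κ) (R := R) hz
  have hle : 2 * ‖z‖ - (1 - κ * R ^ 2) ≤
      Real.sqrt ((1 - κ * R ^ 2) ^ 2 + 4 * (κ * R ^ 2) * ‖z‖ ^ 2) := by
    apply Real.le_sqrt_of_sq_le
    nlinarith [mul_nonneg (mul_nonneg (norm_nonneg z) hk.le) (sub_nonneg.2 hz)]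
  have hs := Real.sqrt_nonneg ((1 - κ * R ^ 2) ^ 2 + 4 * (κ * R ^ 2) * ‖z‖ ^ 2)
  rw [PhiSymm, norm_mul, Complex.norm_real, Real.norm_of_nonneg (by positivity), div_mul_eq_mul_div,
    div_le_iff₀ (by positivity)]
  nlinarith

lemma norm_Phi {z : ℂ} (hz : ‖z‖ ≤ R) :
    ‖Phi κ R z‖ = (1 - κ * R ^ 2) / (1 - κ * ‖z‖ ^ 2) * (‖z‖ / R) := by
  have hk := one_sub_kR_pos hR hκ
  have hd := one_sub_pos hκ (norm_nonneg z) hz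
  rw [Phi, norm_mul, norm_div, Complex.norm_real, Complex.norm_real,
    Real.norm_of_nonneg (by positivity), Real.norm_of_nonneg hR.le]

lemma norm_Phi_le {z : ℂ} (hz : ‖z‖ ≤ R) : ‖Phi κ R z‖ ≤ 1 := by
  have hk := one_sub_kR_pos hR hκ
  have hd := one_sub_pos hκ (norm_nonneg z) hz
  have h1 : 0 ≤ 1 + κ * (R * ‖z‖) := by
    have h2 : R * ‖z‖ ≤ R ^ 2 := by nlinarith
    have h3 := neg_abs_le κ
    have h4 : 0 ≤ R * ‖z‖ := by positivity
    nlinarith [abs_nonneg κ]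
  rw [norm_Phi hR hκ hz, div_mul_div_comm, div_le_one (by positivity)]
  -- `R(1 - κr²) - (1 - κR²)r = (R - r)(1 + κRr)` with `r = ‖z‖`.
  nlinarith [mul_nonneg h1 (sub_nonneg.2 hz)]

/-- With `ρ = ‖z‖`, the radius `r` of the preimage solves `κRρ r² + (1 - κR²) r - Rρ = 0`. `PhiSymm`
uses the root that stays finite as `κ → 0`, in rationalized form. -/
lemma Phi_PhiSymm {z : ℂ} (hz : ‖z‖ ≤ 1) : Phi κ R (PhiSymm κ R z) = z := by
  have hk := one_sub_kR_pos hR hκ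
  have hd := disc_nonneg (κ := κ) (R := R) hz
  have hs := Real.sqrt_nonneg ((1 - κ * R ^ 2) ^ 2 + 4 * (κ * R ^ 2) * ‖z‖ ^ 2)
  have hsq := Real.sq_sqrt hd
  set Q := Real.sqrt ((1 - κ * R ^ 2) ^ 2 + 4 * (κ * R ^ 2) * ‖z‖ ^ 2) with hQ
  have hP : 0 < 1 - κ * R ^ 2 + Q := by positivity
  have hn : 1 - κ * ‖PhiSymm κ R z‖ ^ 2 = 2 * (1 - κ * R ^ 2) / (1 - κ * R ^ 2 + Q) := by
    rw [PhiSymm, norm_mul, Complex.norm_real, mul_pow, Real.norm_eq_abs, sq_abs, ← hQ, eq_div_iff hP.ne']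
    field_simp
    linear_combination hsq
  have hfac : (1 - κ * R ^ 2) / (2 * (1 - κ * R ^ 2) / (1 - κ * R ^ 2 + Q)) *
      (2 * R / (1 - κ * R ^ 2 + Q)) / R = 1 := by
    generalize 1 - κ * R ^ 2 + Q = P at hP
    generalize 1 - κ * R ^ 2 = A at hk
    field_simp
  rw [Phi, hn, PhiSymm, ← hQ]
  calc _ = (((1 - κ * R ^ 2) / (2 * (1 - κ * R ^ 2) / (1 - κ * R ^ 2 + Q)) *
      (2 * R / (1 - κ * R ^ 2 + Q)) / R : ℝ) : ℂ) * z := by push_cast; ring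
    _ = z := by rw [hfac, Complex.ofReal_one, one_mul]

lemma PhiSymm_Phi {z : ℂ} (hz : ‖z‖ ≤ R) : PhiSymm κ R (Phi κ R z) = z := by
  have hk := one_sub_kR_pos hR hκ
  have hd := one_sub_pos hκ (norm_nonneg z) hz
  have hd' := one_add_pos hκ (norm_nonneg z) hz
  have hn : Real.sqrt ((1 - κ * R ^ 2) ^ 2 + 4 * (κ * R ^ 2) * ‖Phi κ R z‖ ^ 2) =
      (1 - κ * R ^ 2) * (1 + κ * ‖z‖ ^ 2) / (1 - κ * ‖z‖ ^ 2) := by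
    rw [Real.sqrt_eq_iff_mul_self_eq_of_pos (by positivity), norm_Phi hR hκ hz]
    field_simp
    ring
  have hfac : 2 * R / (1 - κ * R ^ 2 + (1 - κ * R ^ 2) * (1 + κ * ‖z‖ ^ 2) / (1 - κ * ‖z‖ ^ 2)) *
      ((1 - κ * R ^ 2) / (1 - κ * ‖z‖ ^ 2)) / R = 1 := by
    generalize 1 - κ * R ^ 2 = A at hk
    have h2 : A + A * (1 + κ * ‖z‖ ^ 2) / (1 - κ * ‖z‖ ^ 2) = 2 * A / (1 - κ * ‖z‖ ^ 2) := by
      field_simp; ring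
    rw [h2]
    generalize 1 - κ * ‖z‖ ^ 2 = B at hd
    field_simp
  rw [PhiSymm, hn, Phi]
  calc _ = ((2 * R / (1 - κ * R ^ 2 + (1 - κ * R ^ 2) * (1 + κ * ‖z‖ ^ 2) / (1 - κ * ‖z‖ ^ 2)) *
      ((1 - κ * R ^ 2) / (1 - κ * ‖z‖ ^ 2)) / R : ℝ) : ℂ) * z := by push_cast; ring
    _ = z := by rw [hfac, Complex.ofReal_one, one_mul]

lemma bijOn_Phi : BijOn (Phi κ R) (closedBall 0 R) (closedBall 0 1) :=
  InvOn.bijOn (f' := PhiSymm κ R)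
    ⟨fun _ h => PhiSymm_Phi hR hκ (mem_closedBall_zero_iff.1 h),
      fun _ h => Phi_PhiSymm hR hκ (mem_closedBall_zero_iff.1 h)⟩
    (fun _ h => mem_closedBall_zero_iff.2 (norm_Phi_le hR hκ (mem_closedBall_zero_iff.1 h)))
    (fun _ h => mem_closedBall_zero_iff.2 (norm_PhiSymm_le hR hκ (mem_closedBall_zero_iff.1 h)))

lemma PhiInv_eq {z : ℂ} (hz : ‖z‖ ≤ 1) : PhiInv κ R z = PhiSymm κ R z := by
  have hb := bijOn_Phi hR hκ
  have hz' : z ∈ closedBall (0 : ℂ) 1 := mem_closedBall_zero_iff.2 hz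
  refine hb.injOn (hb.surjOn.mapsTo_invFunOn hz')
    (mem_closedBall_zero_iff.2 (norm_PhiSymm_le hR hκ hz)) ?_
  rw [Phi_PhiSymm hR hκ hz]
  exact hb.surjOn.rightInvOn_invFunOn hz'

omit hR hκ in
lemma hasFDerivAt_Phi {z : ℂ} (hd : 1 - κ * ‖z‖ ^ 2 ≠ 0) :
    HasFDerivAt (Phi κ R) (((1 - κ * R ^ 2) / R / (1 - κ * ‖z‖ ^ 2)) • ContinuousLinearMap.id ℝ ℂ +
      ((1 - κ * R ^ 2) / R * (2 * κ) / (1 - κ * ‖z‖ ^ 2) ^ 2) • (innerSL ℝ z).smulRight z) z := by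
  have h1 : HasFDerivAt (fun x : ℂ => 1 - κ * ‖x‖ ^ 2) (-(κ • (2 • innerSL ℝ z))) z :=
    ((hasStrictFDerivAt_norm_sq z).hasFDerivAt.const_mul κ).const_sub 1
  have h2 : HasFDerivAt (fun x : ℂ => (1 - κ * R ^ 2) / R * (1 - κ * ‖x‖ ^ 2)⁻¹)
      (((1 - κ * R ^ 2) / R * (2 * κ) / (1 - κ * ‖z‖ ^ 2) ^ 2) • innerSL ℝ z) z := by
    refine (((hasDerivAt_inv hd).comp_hasFDerivAt z h1).const_mul _).congr_fderiv ?_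
    ext v
    simp
    field_simp
  have h3 := h2.smul (hasFDerivAt_id z)
  have h4 : Phi κ R = fun x : ℂ => ((1 - κ * R ^ 2) / R * (1 - κ * ‖x‖ ^ 2)⁻¹) • id x := by
    ext x
    simp only [Phi, Complex.real_smul, id]
    push_cast
    ring
  rw [h4]
  refine h3.congr_fderiv ?_
  ext v
  simp
  ring

omit hR hκ in
-- The eigenvalues are `s` on the orthogonal complement of `z` and `s + t‖z‖²` along `z`.
lemma det_smul_id_add_smulRight (z : ℂ) (s t : ℝ) :
    (s • ContinuousLinearMap.id ℝ ℂ + t • (innerSL ℝ z).smulRight z).det =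
      s * (s + t * ‖z‖ ^ 2) := by
  rw [ContinuousLinearMap.det, ← LinearMap.det_toMatrix Complex.basisOneI, Matrix.det_fin_two,
    Complex.sq_norm, Complex.normSq_apply]
  simp [LinearMap.toMatrix_apply, Complex.coe_basisOneI_repr, Complex.coe_basisOneI, Complex.inner]
  ring

omit hR hκ in
lemma det_fderiv_Phi {z : ℂ} (hd : 1 - κ * ‖z‖ ^ 2 ≠ 0) (a : ℝ) :
    ((a / (1 - κ * ‖z‖ ^ 2)) • ContinuousLinearMap.id ℝ ℂ +
      (a * (2 * κ) / (1 - κ * ‖z‖ ^ 2) ^ 2) • (innerSL ℝ z).smulRight z).det =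
      a ^ 2 * ((1 + κ * ‖z‖ ^ 2) / (1 - κ * ‖z‖ ^ 2) ^ 3) := by
  rw [det_smul_id_add_smulRight]
  field_simp
  ring

omit hR hκ in
lemma sqrt_det_metric (z : ℂ) : Real.sqrt (metric κ z).det = ((1 + κ * ‖z‖ ^ 2) ^ 2)⁻¹ := by
  rw [metric, Matrix.det_smul, Matrix.det_one, mul_one, Fintype.card_fin, Real.sqrt_sq (by positivity)]

omit hR hκ in
lemma ae_area_mem : ∀ᵐ z ∂(area κ R), ‖z‖ ≤ R := by
  rw [area]
  refine (withDensity_absolutelyContinuous _ _).ae_le ?_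
  filter_upwards [ae_restrict_mem measurableSet_closedBall] with z hz
  exact mem_closedBall_zero_iff.1 hz

omit hR in
lemma weight_pos {z : ℂ} (hz : ‖z‖ ≤ R) : 0 < weight κ z :=
  div_pos (one_add_pos hκ (norm_nonneg z) hz) (one_sub_pos hκ (norm_nonneg z) hz)

omit hR in
lemma exists_weight_bounds : ∃ m M : ℝ, 0 < m ∧ 0 < M ∧
    ∀ z : ℂ, ‖z‖ ≤ R → m ≤ weight κ z ∧ weight κ z ≤ M := by
  have hq : |κ| * R ^ 2 < 1 := by rwa [mul_comm]
  refine ⟨(1 - |κ| * R ^ 2) / (1 + |κ| * R ^ 2), (1 + |κ| * R ^ 2) / (1 - |κ| * R ^ 2),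
    div_pos (by linarith) (by positivity), div_pos (by positivity) (by linarith), fun z hz => ?_⟩
  have h1 := one_add_pos hκ (norm_nonneg z) hz
  have h2 := one_sub_pos hκ (norm_nonneg z) hz
  have h3 : |κ * ‖z‖ ^ 2| ≤ |κ| * R ^ 2 := by
    rw [abs_mul, abs_of_nonneg (sq_nonneg ‖z‖)]; gcongr
  obtain ⟨h4, h5⟩ := abs_le.1 h3
  constructor <;> unfold weight <;> apply div_le_div₀ <;> linarith

lemma isWeightedEquiv_Phi : IsWeightedEquiv (area κ R) (area 0 1) (Phi κ R) (PhiSymm κ R)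
    (fun z => weight κ z ^ 3) (R ^ 2 / (1 - κ * R ^ 2) ^ 2) := by
  have hk := one_sub_kR_pos hR hκ
  obtain ⟨m, M, hm, hM, hw⟩ := exists_weight_bounds hκ
  refine ⟨measurable_Phi κ R, measurable_PhiSymm κ R, (measurable_weight κ).pow_const 3,
    ⟨m ^ 3, by positivity, ?_⟩, ⟨M ^ 3, ?_⟩, by positivity, ?_, ?_⟩
  · filter_upwards [ae_area_mem] with z hz
    exact pow_le_pow_left₀ hm.le (hw z hz).1 3
  · filter_upwards [ae_area_mem] with z hz
    exact pow_le_pow_left₀ (weight_pos hκ hz).le (hw z hz).2 3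
  · refine Measure.ext_of_lintegral _ fun g hg => ?_
    have hgm : Measurable fun z => g (Phi κ R z) := hg.comp (measurable_Phi κ R)
    have hwm : Measurable fun z => ENNReal.ofReal (weight κ z ^ 3) :=
      ((measurable_weight κ).pow_const 3).ennreal_ofReal
    have hdm : Measurable fun z => ENNReal.ofReal (Real.sqrt (metric κ z).det) := by
      simp only [sqrt_det_metric]; fun_prop
    rw [lintegral_map hg (measurable_Phi κ R), lintegral_withDensity_eq_lintegral_mul _ hwm hgm,
      area, lintegral_withDensity_eq_lintegral_mul _ hdm (hwm.mul hgm), lintegral_smul_measure,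
      area_zero_one, ← (bijOn_Phi hR hκ).image_eq,
      lintegral_image_eq_lintegral_abs_det_fderiv_mul volume measurableSet_closedBall
        (fun z hz => (hasFDerivAt_Phi
          (one_sub_pos hκ (norm_nonneg z) (mem_closedBall_zero_iff.1 hz)).ne').hasFDerivWithinAt)
        (bijOn_Phi hR hκ).injOn, smul_eq_mul, ← lintegral_const_mul' _ _ ENNReal.ofReal_ne_top]
    refine setLIntegral_congr_fun measurableSet_closedBall fun z hz => ?_
    have hz' := mem_closedBall_zero_iff.1 hz
    have h1 := one_add_pos hκ (norm_nonneg z) hz'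
    have h2 := one_sub_pos hκ (norm_nonneg z) hz'
    simp only [Pi.mul_apply]
    rw [det_fderiv_Phi h2.ne', ← mul_assoc, ← mul_assoc, ← ENNReal.ofReal_mul (Real.sqrt_nonneg _),
      ← ENNReal.ofReal_mul (by positivity), sqrt_det_metric, abs_of_nonneg (by positivity), weight]
    congr 2
    generalize 1 - κ * R ^ 2 = A at hk
    field_simp
  · filter_upwards [ae_area_mem] with z hz
    exact PhiSymm_Phi hR hκ hz

/-! ### The fibre map and the boundary measures -/

/-- The derivative of `s`. -/
def sDeriv (κ R α : ℝ) : ℝ := (1 - κ * R ^ 2) * (1 + κ * R ^ 2) / fibreNorm κ R α ^ 2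

omit hR hκ in
lemma measurable_sDeriv : Measurable (sDeriv κ R) := by
  unfold sDeriv fibreNorm; fun_prop

omit hR hκ in
lemma measurable_sMap : Measurable (sMap κ R) := by
  have : Measurable Real.tan := by
    have h : Real.tan = fun x => Real.sin x / Real.cos x := funext Real.tan_eq_sin_div_cos
    rw [h]; fun_prop
  exact Real.measurable_arctan.comp (this.const_mul _)

lemma sDeriv_pos (α : ℝ) : 0 < sDeriv κ R α := by
  have h1 := one_sub_kR_pos hR hκ
  have h2 := one_add_kR_pos hR hκ
  have := fibreNorm_pos hR hκ α
  unfold sDeriv; positivity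

lemma exists_sDeriv_bounds : ∃ m M : ℝ, 0 < m ∧ 0 < M ∧
    ∀ α, m ≤ sDeriv κ R α ∧ sDeriv κ R α ≤ M := by
  have h1 := one_sub_kR_pos hR hκ
  have h2 := one_add_kR_pos hR hκ
  set n := min ((1 + κ * R ^ 2) ^ 2) ((1 - κ * R ^ 2) ^ 2) with hn
  have hn0 : 0 < n := lt_min (by positivity) (by positivity)
  refine ⟨(1 - κ * R ^ 2) * (1 + κ * R ^ 2) / ((1 + κ * R ^ 2) ^ 2 + (1 - κ * R ^ 2) ^ 2),
    (1 - κ * R ^ 2) * (1 + κ * R ^ 2) / n, by positivity, by positivity, fun α => ?_⟩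
  have hf := fibreNorm_pos hR hκ α
  have hle : fibreNorm κ R α ^ 2 ≤ (1 + κ * R ^ 2) ^ 2 + (1 - κ * R ^ 2) ^ 2 := by
    rw [fibreNorm_sq hR hκ]
    refine add_le_add (mul_le_of_le_one_right (sq_nonneg _) (Real.cos_sq_le_one α))
      (mul_le_of_le_one_right (sq_nonneg _) (Real.sin_sq_le_one α))
  have hge : n ≤ fibreNorm κ R α ^ 2 := by
    rw [fibreNorm_sq hR hκ]
    calc n = n * Real.cos α ^ 2 + n * Real.sin α ^ 2 := by
          rw [← mul_add, Real.cos_sq_add_sin_sq, mul_one]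
      _ ≤ _ := by
          gcongr
          · exact min_le_left _ _
          · exact min_le_right _ _
  constructor <;> unfold sDeriv <;> gcongr

lemma deriv_sMap {α : ℝ} (hα : α ∈ fibre) : deriv (sMap κ R) α = sDeriv κ R α :=
  (hasDerivAt_sMap hR hκ hα).deriv

omit hR hκ in
lemma ae_boundary_mem : ∀ᵐ p ∂(boundaryMeasure κ R), p.2 ∈ fibre := by
  rw [boundaryMeasure]
  refine Measure.ae_smul_measure ?_ _
  exact Measure.quasiMeasurePreserving_snd.ae (ae_restrict_mem measurableSet_fibre)

lemma isWeightedEquiv_sMap : IsWeightedEquiv (boundaryMeasure κ R) (boundaryMeasure 0 1)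
    (fun p => (p.1, sMap κ R p.2)) (fun p => (p.1, sMap (-κ) R p.2))
    (fun p => sDeriv κ R p.2) (R / (1 + κ * R ^ 2)) := by
  have h2 := one_add_kR_pos hR hκ
  have hφ : Measurable fun p : AddCircle (2 * π) × ℝ => (p.1, sMap κ R p.2) :=
    measurable_fst.prodMk (measurable_sMap.comp measurable_snd)
  have hJ : Measurable fun p : AddCircle (2 * π) × ℝ => sDeriv κ R p.2 :=
    measurable_sDeriv.comp measurable_snd
  obtain ⟨m, M, hm, hM, hb⟩ := exists_sDeriv_bounds hR hκ
  refine ⟨hφ, measurable_fst.prodMk (measurable_sMap.comp measurable_snd), hJ,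
    ⟨m, hm, Filter.Eventually.of_forall fun p => (hb p.2).1⟩,
    ⟨M, Filter.Eventually.of_forall fun p => (hb p.2).2⟩, by positivity, ?_, ?_⟩
  · refine Measure.ext_of_lintegral _ fun g hg => ?_
    have hgm : Measurable fun p : AddCircle (2 * π) × ℝ => g (p.1, sMap κ R p.2) := hg.comp hφ
    rw [lintegral_map hg hφ, lintegral_withDensity_eq_lintegral_mul _ hJ.ennreal_ofReal hgm,
      lintegral_smul_measure, boundaryMeasure, lintegral_smul_measure, boundaryMeasure_zero_one,
      lintegral_prod _ (hJ.ennreal_ofReal.mul hgm).aemeasurable, lintegral_prod _ hg.aemeasurable]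
    congr 2 with β
    conv_rhs => rw [← (bijOn_sMap hR hκ).image_eq]
    rw [lintegral_image_eq_lintegral_abs_deriv_mul measurableSet_fibre
      (fun α hα => (hasDerivAt_sMap hR hκ hα).hasDerivWithinAt) (bijOn_sMap hR hκ).injOn]
    refine setLIntegral_congr_fun measurableSet_fibre fun α _ => ?_
    have := sDeriv_pos hR hκ α
    simp only [Pi.mul_apply]
    rw [← sDeriv, abs_of_pos this]
  · filter_upwards [ae_boundary_mem] with p hp
    rw [sMap_neg_sMap hR hκ hp]

end

/-! ### The intertwined operators -/

lemma inv_le_inv_abs {m x : ℝ} (hm : 0 < m) (h : m ≤ x) : |x⁻¹| ≤ m⁻¹ := by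
  rw [abs_of_pos (inv_pos.2 (hm.trans_le h))]
  exact inv_anti₀ hm h

section
variable {κ R : ℝ} (hR : 0 < R) (hκ : R ^ 2 * |κ| < 1)
include hR hκ

lemma dualConst_mul_consts : dualConst κ R * (R ^ 2 / (1 - κ * R ^ 2) ^ 2) /
    (R / (1 + κ * R ^ 2)) = Real.sqrt ((1 + κ * R ^ 2) / (1 - κ * R ^ 2)) := by
  have h1 := one_sub_kR_pos hR hκ
  have h2 := one_add_kR_pos hR hκ
  rw [dualConst_eq hR hκ, Real.sqrt_div h2.le]
  have h3 := Real.sq_sqrt h1.le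
  have h4 := Real.sq_sqrt h2.le
  have h5 := Real.sqrt_pos.2 h1
  have h6 := Real.sqrt_pos.2 h2
  generalize Real.sqrt (1 - κ * R ^ 2) = a at *
  generalize Real.sqrt (1 + κ * R ^ 2) = b at *
  rw [← h3, ← h4]
  field_simp

/-- The X-ray transform of `(𝔻_R, g_κ)` obtained from the Euclidean one by intertwining. -/
lemma isXrayOperator_conj {I₀e : Lp ℂ 2 (area 0 1) →L[ℂ] Lp ℂ 2 (boundaryMeasure 0 1)}
    (hI : IsXrayOperator 0 1 I₀e)
    {W : Lp ℂ 2 (area κ R) →L[ℂ] Lp ℂ 2 (area 0 1)}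
    (hW : ∀ f, W f =ᵐ[area 0 1] fun z =>
      (((weight κ (PhiSymm κ R z) ^ 2)⁻¹ : ℝ) : ℂ) * f (PhiSymm κ R z))
    {V : Lp ℂ 2 (boundaryMeasure 0 1) →L[ℂ] Lp ℂ 2 (boundaryMeasure κ R)}
    (hV : ∀ h, V h =ᵐ[boundaryMeasure κ R] fun p =>
      (Real.sqrt (sDeriv κ R p.2) : ℂ) * h (p.1, sMap κ R p.2)) :
    IsXrayOperator κ R ((dualConst κ R : ℂ)⁻¹ • V.comp (I₀e.comp W)) := by
  intro f
  have hs := isWeightedEquiv_sMap hR hκ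
  set g : ℂ → ℂ := fun z => (((weight κ (PhiSymm κ R z) ^ 2)⁻¹ : ℝ) : ℂ) * f (PhiSymm κ R z)
  have hgf : ∀ z : ℂ, ‖z‖ ≤ R → (weight κ z : ℂ) ^ 2 * g (Phi κ R z) = f z := by
    intro z hz
    have hw : (weight κ z : ℂ) ≠ 0 := by exact_mod_cast (weight_pos hκ hz).ne'
    simp only [g, PhiSymm_Phi hR hκ hz]
    push_cast
    field_simp
  -- `W f` and the formula `g` agree only almost everywhere, so the exceptional lines are discarded
  -- in the Euclidean disk and then pulled back through `s`.
  have hline : ∀ᵐ p ∂(boundaryMeasure 0 1), p.2 ∈ fibre →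
      (xray 0 1 (W f) p = xray 0 1 g p ∧
        IntervalIntegrable (fun t => g ((chord 0 1 p).2 t)) volume 0 (chord 0 1 p).1) := by
    filter_upwards [hI (W f), lineIntegral_congr_ae (hW f), ae_line_of_ae (hW f)] with p h1 h2 h3 hp
    have hpos : 0 ≤ 2 * Real.cos p.2 := by
      have := cos_pos_of_mem_fibre hp; positivity
    refine ⟨by rw [xray_zero_one_eq hp, xray_zero_one_eq hp, h2], ?_⟩
    have h4 := h1.1
    rw [intervalIntegrable_chord_iff one_pos (by simp) (isChord_line hp),
      intervalIntegrable_iff_integrableOn_Icc_of_le hpos] at h4 ⊢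
    refine h4.congr ?_
    filter_upwards [ae_restrict_of_ae h3, ae_restrict_mem measurableSet_Icc] with S hS hmem
    exact hS ((line_mem_closedBall_iff hp S).2 hmem)
  have hcoe : ((dualConst κ R : ℂ)⁻¹ • V.comp (I₀e.comp W)) f =ᵐ[boundaryMeasure κ R]
      fun p => (dualConst κ R : ℂ)⁻¹ * V (I₀e (W f)) p := by
    rw [smul_apply]
    filter_upwards [Lp.coeFn_smul (dualConst κ R : ℂ)⁻¹ (V (I₀e (W f)))] with p hp
    exact hp
  filter_upwards [hs.quasi.ae hline, hs.quasi.ae (hI (W f)), hV (I₀e (W f)), hcoe,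
    ae_boundary_mem] with p h1 h2 h3 h4 hp
  obtain ⟨h5, h6⟩ := h1 (sMap_mem_fibre _ _ _)
  have hchord := isChord_chord hR hκ hp
  have hnorm : ∀ t ∈ Icc 0 (chord κ R p).1, ‖(chord κ R p).2 t‖ ≤ R :=
    fun t ht => hchord.norm_le hR ht
  constructor
  · rw [intervalIntegrable_chord_sMap hR hκ g hp] at h6
    refine (intervalIntegrable_congr fun t ht => ?_).1 h6
    rw [uIoc_of_le hchord.1.le] at ht
    exact hgf _ (hnorm t (Ioc_subset_Icc_self ht))
  · have h7 : xray κ R (fun z => (weight κ z : ℂ) ^ 2 * g (Phi κ R z)) p = xray κ R f p := by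
      refine intervalIntegral.integral_congr fun t ht => ?_
      rw [uIcc_of_le hchord.1.le] at ht
      exact hgf _ (hnorm t ht)
    have hC : (dualConst κ R : ℂ) ≠ 0 := by exact_mod_cast (dualConst_pos hR hκ).ne'
    have hq : (Real.sqrt (sDeriv κ R p.2) : ℂ) ≠ 0 := by
      exact_mod_cast (Real.sqrt_pos.2 (sDeriv_pos hR hκ p.2)).ne'
    rw [h4, h3, h2.2, h5, xray_sMap hR hκ g hp, h7, deriv_sMap hR hκ hp]
    field_simp

/-- With `I₀` built by conjugation, the second relation is inversion of the weighted compositions,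
and the first is its adjoint. -/
lemma exists_operators :
    ∃ (I₀ : Lp ℂ 2 (area κ R) →L[ℂ] Lp ℂ 2 (boundaryMeasure κ R))
      (I₀e : Lp ℂ 2 (area 0 1) →L[ℂ] Lp ℂ 2 (boundaryMeasure 0 1)),
      IsXrayOperator κ R I₀ ∧ IsXrayOperator 0 1 I₀e ∧
      (∀ h : Lp ℂ 2 (boundaryMeasure 0 1), ∃ H : Lp ℂ 2 (boundaryMeasure κ R),
        (∀ᵐ p ∂(boundaryMeasure κ R),
          H p = (Real.sqrt (deriv (sMap κ R) p.2) : ℂ) * h (p.1, sMap κ R p.2)) ∧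
        (∀ᵐ z ∂(area 0 1),
          (Real.sqrt ((1 + κ * R ^ 2) / (1 - κ * R ^ 2)) : ℂ) *
            ((weight κ (PhiInv κ R z) : ℂ)⁻¹ *
              (ContinuousLinearMap.adjoint I₀ H) (PhiInv κ R z)) =
          (ContinuousLinearMap.adjoint I₀e h) z)) ∧
      (∀ f : Lp ℂ 2 (area 0 1), ∃ F : Lp ℂ 2 (area κ R),
        (∀ᵐ z ∂(area κ R), F z = (weight κ z : ℂ) ^ 2 * f (Phi κ R z)) ∧
        (∀ᵐ p ∂(boundaryMeasure 0 1),
          I₀e f p =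
            (dualConst κ R : ℂ) * ((Real.sqrt (deriv (sMap κ R) (sInv κ R p.2)) : ℂ)⁻¹ *
              I₀ F (p.1, sInv κ R p.2)))) := by
  obtain ⟨I₀e, hI⟩ := exists_isXrayOperator_zero_one
  have hΦ := isWeightedEquiv_Phi hR hκ
  have hs := isWeightedEquiv_sMap hR hκ
  obtain ⟨m, M, hm, hM, hw⟩ := exists_weight_bounds hκ
  obtain ⟨m', M', hm', hM', hs'⟩ := exists_sDeriv_bounds hR hκ
  obtain ⟨W₁, hW₁⟩ := hΦ.exists_comp (a := fun z => weight κ z ^ 2)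
    ((measurable_weight κ).pow_const 2) ⟨M ^ 2, by
      filter_upwards [ae_area_mem] with z hz
      rw [abs_of_nonneg (sq_nonneg _)]
      exact pow_le_pow_left₀ (weight_pos hκ hz).le (hw z hz).2 2⟩
  obtain ⟨W₂, hW₂⟩ := hΦ.exists_comp_symm (b := fun z => (weight κ z)⁻¹)
    (measurable_weight κ).inv ⟨m⁻¹, by
      filter_upwards [ae_area_mem] with z hz
      exact inv_le_inv_abs hm (hw z hz).1⟩
  obtain ⟨W, hW⟩ := hΦ.exists_comp_symm (b := fun z => (weight κ z ^ 2)⁻¹)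
    ((measurable_weight κ).pow_const 2).inv ⟨(m ^ 2)⁻¹, by
      filter_upwards [ae_area_mem] with z hz
      exact inv_le_inv_abs (by positivity) (pow_le_pow_left₀ hm.le (hw z hz).1 2)⟩
  have hmJ : Measurable fun p : AddCircle (2 * π) × ℝ => Real.sqrt (sDeriv κ R p.2) :=
    (measurable_sDeriv.comp measurable_snd).sqrt
  obtain ⟨V₂, hV₂⟩ := hs.exists_comp (a := fun p => Real.sqrt (sDeriv κ R p.2)) hmJ
    ⟨Real.sqrt M', Filter.Eventually.of_forall fun p => by
      rw [abs_of_nonneg (Real.sqrt_nonneg _)]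
      exact Real.sqrt_le_sqrt (hs' p.2).2⟩
  obtain ⟨V₁, hV₁⟩ := hs.exists_comp_symm (b := fun p => (Real.sqrt (sDeriv κ R p.2))⁻¹) hmJ.inv
    ⟨(Real.sqrt m')⁻¹, Filter.Eventually.of_forall fun p =>
      inv_le_inv_abs (Real.sqrt_pos.2 hm') (Real.sqrt_le_sqrt (hs' p.2).1)⟩
  have hC : (dualConst κ R : ℂ) ≠ 0 := by exact_mod_cast (dualConst_pos hR hκ).ne'
  have hsq : ∀ α, (Real.sqrt (sDeriv κ R α) : ℂ) ≠ 0 := fun α => by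
    exact_mod_cast (Real.sqrt_pos.2 (sDeriv_pos hR hκ α)).ne'
  have hX := isXrayOperator_conj hR hκ hI hW hV₂
  -- Naming the conjugated operator through an equation keeps it opaque, so that its adjoint is not
  -- unfolded.
  obtain ⟨I₀, hI₀⟩ : ∃ I₀, I₀ = (dualConst κ R : ℂ)⁻¹ • V₂.comp (I₀e.comp W) := ⟨_, rfl⟩
  rw [← hI₀] at hX
  have hWW : ∀ f, W (W₁ f) = f := by
    intro f
    refine Lp.ext ?_
    filter_upwards [hW (W₁ f), hΦ.quasi_symm.ae (hW₁ f), ae_area_mem (κ := 0) (R := 1)]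
      with z h1 h2 hz
    have hw0 : (weight κ (PhiSymm κ R z) : ℂ) ≠ 0 := by
      exact_mod_cast (weight_pos hκ (norm_PhiSymm_le hR hκ hz)).ne'
    rw [h1, h2, Phi_PhiSymm hR hκ hz]
    push_cast
    field_simp
  have hVV : ∀ h, V₁ (V₂ h) = h := by
    intro h
    refine Lp.ext ?_
    filter_upwards [hV₁ (V₂ h), hs.quasi_symm.ae (hV₂ h), ae_mem_fibre_zero_one] with p h1 h2 hp
    have := hsq (sMap (-κ) R p.2)
    rw [h1, h2]
    simp only [sMap_sMap_neg hR hκ hp]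
    push_cast
    field_simp
  have hfactor : ∀ f, I₀e f = (dualConst κ R : ℂ) • V₁ (I₀ (W₁ f)) := by
    intro f
    simp only [hI₀, smul_apply, ContinuousLinearMap.comp_apply, hWW, map_smul,
      hVV, smul_smul]
    rw [mul_inv_cancel₀ hC, one_smul]
  have hadj : ∀ h, ContinuousLinearMap.adjoint I₀e h =
      (Real.sqrt ((1 + κ * R ^ 2) / (1 - κ * R ^ 2)) : ℂ) •
        W₂ (ContinuousLinearMap.adjoint I₀ (V₂ h)) := by
    intro h
    -- Move `V₁` and then `I₀` and `W₁` across the inner product. The constants collected are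
    -- `dualConst`, the inverse of the one for `s`, and the one for `Φ`.
    refine ext_inner_left ℂ fun f => ?_
    have e1 := hΦ.inner_comp (a := fun z => weight κ z ^ 2) (b := fun z => (weight κ z)⁻¹)
      (measurable_weight κ).inv (by
      filter_upwards [ae_area_mem] with z hz
      have := (weight_pos hκ hz).ne'
      field_simp) hW₁ hW₂ f (ContinuousLinearMap.adjoint I₀ (V₂ h))
    have e2 := hs.inner_comp (a := fun p => Real.sqrt (sDeriv κ R p.2))
      (b := fun p => (Real.sqrt (sDeriv κ R p.2))⁻¹) hmJ.inv
      (Filter.Eventually.of_forall fun p => by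
        have := (Real.sqrt_pos.2 (sDeriv_pos hR hκ p.2)).ne'
        have h4 := Real.mul_self_sqrt (sDeriv_pos hR hκ p.2).le
        rw [mul_inv_eq_iff_eq_mul₀ this, h4]) hV₂ hV₁ h (I₀ (W₁ f))
    have e3 : inner ℂ (V₁ (I₀ (W₁ f))) h =
        (((R / (1 + κ * R ^ 2) : ℝ) : ℂ))⁻¹ * inner ℂ (I₀ (W₁ f)) (V₂ h) := by
      have hc : ((R / (1 + κ * R ^ 2) : ℝ) : ℂ) ≠ 0 := by exact_mod_cast hs.const_pos.ne'
      rw [← inner_conj_symm, ← inner_conj_symm (I₀ (W₁ f)), e2, map_mul, Complex.conj_ofReal,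
        inv_mul_cancel_left₀ hc]
    rw [ContinuousLinearMap.adjoint_inner_right] at e1 ⊢
    rw [hfactor, inner_smul_left, e3, Complex.conj_ofReal, inner_smul_right, e1,
      ← dualConst_mul_consts hR hκ]
    push_cast
    ring
  refine ⟨I₀, I₀e, hX, hI, fun h => ⟨V₂ h, ?_, ?_⟩,
    fun f => ⟨W₁ f, ?_, ?_⟩⟩
  · filter_upwards [hV₂ h, ae_boundary_mem] with p h1 hp
    rw [h1, deriv_sMap hR hκ hp]
  · rw [hadj]
    generalize ContinuousLinearMap.adjoint I₀ (V₂ h) = G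
    filter_upwards [Lp.coeFn_smul (Real.sqrt ((1 + κ * R ^ 2) / (1 - κ * R ^ 2)) : ℂ)
      (W₂ G), hW₂ G, ae_area_mem (κ := 0) (R := 1)] with z h1 h2 hz
    refine Eq.trans ?_ h1.symm
    rw [Pi.smul_apply, smul_eq_mul, PhiInv_eq hR hκ hz]
    refine congrArg _ (Eq.trans ?_ h2.symm)
    rw [Complex.ofReal_inv]
  · filter_upwards [hW₁ f] with z h1
    rw [h1, Complex.ofReal_pow]
  · rw [hfactor]
    filter_upwards [Lp.coeFn_smul (dualConst κ R : ℂ) (V₁ (I₀ (W₁ f))), hV₁ (I₀ (W₁ f)),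
      ae_mem_fibre_zero_one] with p h1 h2 hp
    rw [h1, Pi.smul_apply, h2, smul_eq_mul, sInv_eq hR hκ hp,
      deriv_sMap hR hκ (sMap_mem_fibre _ _ _), Complex.ofReal_inv]

end

end XrayDisk

end

/-! ### The intertwining theorem -/

open XrayDisk in
theorem theorem4p2 (κ R : ℝ) (hR : 0 < R) (hκ : R ^ 2 * |κ| < 1) :
    -- the maps `Φ : 𝔻_R → 𝔻_1` and `s : (-π/2, π/2) → (-π/2, π/2)` are invertible
    BijOn (Phi κ R) (closedBall 0 R) (closedBall 0 1) ∧
    BijOn (sMap κ R) fibre fibre ∧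
    -- the geodesics that define `I₀` and `I₀ᵉ` exist
    (∀ β : AddCircle (2 * π), ∀ α ∈ fibre,
      IsChord κ R (β, α) (chord κ R (β, α)) ∧ IsChord 0 1 (β, α) (chord 0 1 (β, α))) ∧
    -- dual relation, pointwise on functions
    (∀ (f : ℂ → ℂ) (β : AddCircle (2 * π)), ∀ α ∈ fibre,
      xray 0 1 f (β, α) =
        (dualConst κ R : ℂ) * ((Real.sqrt (deriv (sMap κ R) (sInv κ R α)) : ℂ)⁻¹ *
          xray κ R (fun z => (weight κ z : ℂ) ^ 2 * f (Phi κ R z)) (β, sInv κ R α))) ∧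
    -- both relations for the L² operators and their Hilbert space adjoints
    ∃ (I₀ : Lp ℂ 2 (area κ R) →L[ℂ] Lp ℂ 2 (boundaryMeasure κ R))
      (I₀e : Lp ℂ 2 (area 0 1) →L[ℂ] Lp ℂ 2 (boundaryMeasure 0 1)),
      IsXrayOperator κ R I₀ ∧ IsXrayOperator 0 1 I₀e ∧
      (∀ h : Lp ℂ 2 (boundaryMeasure 0 1), ∃ H : Lp ℂ 2 (boundaryMeasure κ R),
        (∀ᵐ p ∂(boundaryMeasure κ R),
          H p = (Real.sqrt (deriv (sMap κ R) p.2) : ℂ) * h (p.1, sMap κ R p.2)) ∧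
        (∀ᵐ z ∂(area 0 1),
          (Real.sqrt ((1 + κ * R ^ 2) / (1 - κ * R ^ 2)) : ℂ) *
            ((weight κ (PhiInv κ R z) : ℂ)⁻¹ *
              (ContinuousLinearMap.adjoint I₀ H) (PhiInv κ R z)) =
          (ContinuousLinearMap.adjoint I₀e h) z)) ∧
      (∀ f : Lp ℂ 2 (area 0 1), ∃ F : Lp ℂ 2 (area κ R),
        (∀ᵐ z ∂(area κ R), F z = (weight κ z : ℂ) ^ 2 * f (Phi κ R z)) ∧
        (∀ᵐ p ∂(boundaryMeasure 0 1),
          I₀e f p =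
            (dualConst κ R : ℂ) * ((Real.sqrt (deriv (sMap κ R) (sInv κ R p.2)) : ℂ)⁻¹ *
              I₀ F (p.1, sInv κ R p.2)))) := by
  refine ⟨bijOn_Phi hR hκ, bijOn_sMap hR hκ, fun β α hα =>
    ⟨isChord_chord hR hκ hα, isChord_chord one_pos (by simp) hα⟩, fun f β α hα => ?_,
    exists_operators hR hκ⟩
  have h := xray_sMap hR hκ f (p := (β, sInv κ R α)) (by
    rw [sInv_eq hR hκ hα]; exact sMap_mem_fibre _ _ _)
  rwa [show sMap κ R (β, sInv κ R α).2 = α by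
    simp only [sInv_eq hR hκ hα, sMap_sMap_neg hR hκ hα]] at h
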